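/- Let $M$ be a smooth 4-manifold and let $L=|\Lambda^4TM|^{1/4}$ be its density bundle. Let $c$ be a smooth conformal metric on $M$, that is, a metric on $TM$ with values in $L^2$, normalized by $|\det c|=1$, and let $J$ be a smooth almost complex structure on $M$ with $c(JX,JY)=c(X,Y)$. Orient $M$ by $J$ (frames $(u,Ju,v,Jv)$ are positive), and let $\omega_c=c(J\cdot,\cdot)$ be the conformal Kähler form, an $L^2$-valued 2-form. Let $D$ be the canonical Weyl derivative of $(M,c,J)$, that is, the connection on $L$ with $d^D\omega_c=0$, and let $\nabla^D$ be its Weyl connection, that is, the torsion-free connection on $TM$ for which $c$ is parallel ($\nabla^D$ also denotes the connection induced by $\nabla^D$ and $D$ on $L^2$-valued forms). Let $\mathcal Z_+=S(L^2\Lambda^2_+T^*M)$ be the weightless twistor space: the bundle whose fibre at $p$ consists of the self-dual $L^2$-valued 2-forms $\sigma$ at $p$ of norm $\sqrt2$ (in the norm for which the forms $e^i\wedge e^j$, $i<j$, of a $c$-orthonormal coframe are orthonormal). Each $q=\sigma\in\mathcal Z_+$ over $p$ determines an endomorphism $J_q$ of $T_pM$ by $\sigma(X,Y)=c(J_qX,Y)$.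 The tangent space $T_q\mathcal Z_+$ consists of the vectors $X^h+\beta^v$, where $X\in T_pM$ and $\beta$ is an $L^2$-valued 2-form at $p$ with $\beta(J_qX,J_qY)=-\beta(X,Y)$; here $\beta^v=\frac{d}{dt}\big|_{t=0}(\sigma+t\beta)$, and $X^h=ds(X)-(\nabla^D_Xs)^v$ for a local section $s$ with $s(p)=q$. The almost complex structure $\mathcal J_+$ is given by $\mathcal J_+(X^h+\beta^v)=(J_qX)^h+(J_q\beta)^v$ with $(J_q\beta)(X,Y)=\beta(J_qX,Y)$. Then $\omega_c$ defines a smooth global section $s:M\to\mathcal Z_+$, and this section is $\mathcal J_+$-holomorphic: for all $p\in M$ and $Z\in T_pM$ one has $ds(Z)\in T_{s(p)}\mathcal Z_+$ and $$ds(JZ)=\mathcal J_+\,ds(Z).$$ Moreover $\nabla^D_{JZ}\omega_c=J(\nabla^D_Z\omega_c)$, that is, $(\nabla^D_{JZ}\omega_c)(X,Y)=(\nabla^D_Z\omega_c)(JX,Y)$ for all $X,Y,Z\in T_pM$. -/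

import Mathlib

open Bundle Set FiberBundle
open scoped Manifold ContDiff Topology

namespace WeylTwistor

noncomputable section

/-! ### Horizontal and vertical vectors in the total space of a vector bundle -/

section VectorBundleSplitting

set_option linter.unusedSectionVars false

variable {E : Type*} [NormedAddCommGroup E] [NormedSpace ℝ E] [FiniteDimensional ℝ E]
  {H : Type*} [TopologicalSpace H] {I : ModelWithCorners ℝ E H}
  {M : Type*} [TopologicalSpace M] [ChartedSpace H M]
  {F : Type*} [NormedAddCommGroup F] [NormedSpace ℝ F] [FiniteDimensional ℝ F]
  {V : M → Type*} [TopologicalSpace (TotalSpace F V)]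
  [∀ x, AddCommGroup (V x)] [∀ x, Module ℝ (V x)] [∀ x, TopologicalSpace (V x)]
  [FiberBundle F V] [VectorBundle ℝ F V] [IsManifold I 1 M] [ContMDiffVectorBundle 1 F V I]

variable (F) in
/-- The coordinate isomorphism of the fibre over `x` with the model fibre. -/
def fibreCoord (x : M) : V x ≃L[ℝ] F :=
  (trivializationAt F V x).continuousLinearEquivAt ℝ x (mem_baseSet_trivializationAt F V x)

theorem fibreCoord_apply (x : M) (β : V x) :
    fibreCoord F x β = (trivializationAt F V x ⟨x, β⟩).2 := by
  simp [fibreCoord]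

/-- The inclusion of the fibre over `x`, in coordinates, into the total space. -/
def fibreIncl (x : M) (f : F) : TotalSpace F V := ⟨x, (fibreCoord F x).symm f⟩

theorem trivializationAt_fibreIncl (x : M) (g : F) :
    (trivializationAt F V x (fibreIncl x g)).2 = g := by
  have h := fibreCoord_apply (F := F) (V := V) x ((fibreCoord (V := V) F x).symm g)
  rw [ContinuousLinearEquiv.apply_symm_apply] at h
  exact h.symm

variable (I)

theorem mdifferentiable_fibreIncl (x : M) :
    MDifferentiable 𝓘(ℝ, F) (I.prod 𝓘(ℝ, F)) (fibreIncl (F := F) (V := V) x) := by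
  intro f
  rw [mdifferentiableAt_totalSpace]
  refine ⟨mdifferentiableAt_const, ?_⟩
  have : (fun g => (trivializationAt F V (fibreIncl (F := F) (V := V) x f).proj
      (fibreIncl x g)).2) = fun g => g := funext fun g => trivializationAt_fibreIncl x g
  rw [this]
  exact mdifferentiableAt_id

variable {I}

/-- The line `t ↦ q + t β` in the fibre through `q`. -/
def fibreLine (q : TotalSpace F V) (β : V q.proj) (t : ℝ) : TotalSpace F V :=
  ⟨q.proj, q.2 + t • β⟩

variable (I) in
/-- The vertical vector `β^v = d/dt (q + t β)` at `t = 0`. -/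
def verticalVector (q : TotalSpace F V) (β : V q.proj) : TangentSpace (I.prod 𝓘(ℝ, F)) q :=
  mfderiv 𝓘(ℝ, ℝ) (I.prod 𝓘(ℝ, F)) (fibreLine q β) 0 (1 : ℝ)

theorem fibreLine_eq (q : TotalSpace F V) (β : V q.proj) :
    fibreLine q β = fibreIncl q.proj ∘
      fun t : ℝ => fibreCoord F q.proj q.2 + t • fibreCoord F q.proj β := by
  funext t
  simp [fibreLine, fibreIncl]

theorem fibreLine_zero (q : TotalSpace F V) (β : V q.proj) : fibreLine q β 0 = q := by
  simp [fibreLine]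

theorem mdifferentiable_fibreLine (q : TotalSpace F V) (β : V q.proj) :
    MDifferentiable 𝓘(ℝ, ℝ) (I.prod 𝓘(ℝ, F)) (fibreLine q β) := by
  rw [fibreLine_eq]
  refine (mdifferentiable_fibreIncl I q.proj).comp ?_
  rw [mdifferentiable_iff_differentiable]
  fun_prop

theorem verticalVector_eq (q : TotalSpace F V) (β : V q.proj) :
    verticalVector I q β = mfderiv 𝓘(ℝ, F) (I.prod 𝓘(ℝ, F)) (fibreIncl (F := F) (V := V) q.proj)
      (fibreCoord F q.proj q.2) (fibreCoord F q.proj β) := by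
  have h1 : HasDerivAt (fun t : ℝ => fibreCoord F q.proj q.2 + t • fibreCoord F q.proj β)
      (fibreCoord F q.proj β) 0 := by
    simpa using ((hasDerivAt_id (0 : ℝ)).smul_const (fibreCoord F q.proj β)).const_add
      (fibreCoord F q.proj q.2)
  have h2 := h1.hasFDerivAt.hasMFDerivAt
  have h4 : HasMFDerivAt 𝓘(ℝ, F) (I.prod 𝓘(ℝ, F)) (fibreIncl (F := F) (V := V) q.proj)
      (fibreCoord F q.proj q.2 + (0 : ℝ) • fibreCoord F q.proj β)
      (mfderiv 𝓘(ℝ, F) (I.prod 𝓘(ℝ, F)) (fibreIncl (F := F) (V := V) q.proj)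
        (fibreCoord F q.proj q.2)) := by
    rw [zero_smul, add_zero]
    exact (mdifferentiable_fibreIncl I q.proj (fibreCoord F q.proj q.2)).hasMFDerivAt
  have h3 := h4.comp (0 : ℝ) h2
  unfold verticalVector
  rw [fibreLine_eq, h3.mfderiv]
  exact congrArg (mfderiv 𝓘(ℝ, F) (I.prod 𝓘(ℝ, F)) (fibreIncl (F := F) (V := V) q.proj)
    (fibreCoord F q.proj q.2)) (one_smul ℝ (fibreCoord F q.proj β))

variable (I) in
/-- The vertical lift `β ↦ β^v`. -/
def verticalLift (q : TotalSpace F V) : V q.proj →ₗ[ℝ] TangentSpace (I.prod 𝓘(ℝ, F)) q where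
  toFun := verticalVector I q
  map_add' β β' := by
    rw [verticalVector_eq, verticalVector_eq, verticalVector_eq, map_add]
    exact (mfderiv 𝓘(ℝ, F) (I.prod 𝓘(ℝ, F)) (fibreIncl (F := F) (V := V) q.proj)
      (fibreCoord F q.proj q.2)).map_add _ _
  map_smul' a β := by
    rw [verticalVector_eq, verticalVector_eq, map_smul]
    exact (mfderiv 𝓘(ℝ, F) (I.prod 𝓘(ℝ, F)) (fibreIncl (F := F) (V := V) q.proj)
      (fibreCoord F q.proj q.2)).map_smul _ _

variable (nablaV : (σ : (x : M) → V x) → (x : M) → TangentSpace I x →ₗ[ℝ] V x)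

variable (I) in
/-- The differential at `π q` of a local section `s` of the bundle with `s(π q) = q`. -/
def extendDeriv (q : TotalSpace F V) :
    TangentSpace I q.proj →L[ℝ] TangentSpace (I.prod 𝓘(ℝ, F)) q :=
  mfderiv I (I.prod 𝓘(ℝ, F)) (fun y => TotalSpace.mk' F y (extend F q.2 y)) q.proj

/-- The horizontal lift `X^h = ds(X) - (∇_X s)^v` at `q`, where `s` is a local section of the
bundle with `s(π q) = q`. -/
def horizontalLift (q : TotalSpace F V) :
    TangentSpace I q.proj →ₗ[ℝ] TangentSpace (I.prod 𝓘(ℝ, F)) q :=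
  (extendDeriv I q).toLinearMap - verticalLift I q ∘ₗ nablaV (extend F q.2) q.proj

variable (I) in
/-- The differential of the bundle projection. -/
def projVec (q : TotalSpace F V) :
    TangentSpace (I.prod 𝓘(ℝ, F)) q →L[ℝ] TangentSpace I q.proj :=
  mfderiv (I.prod 𝓘(ℝ, F)) I (TotalSpace.proj : TotalSpace F V → M) q

theorem projVec_verticalLift (q : TotalSpace F V) (β : V q.proj) :
    projVec I q (verticalLift I q β) = 0 := by
  have h1 : HasMFDerivAt (I.prod 𝓘(ℝ, F)) I (TotalSpace.proj : TotalSpace F V → M)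
      (fibreLine q β 0) (projVec I q) := by
    rw [fibreLine_zero]; exact (mdifferentiable_proj V q).hasMFDerivAt
  have h2 := h1.comp (0 : ℝ) (mdifferentiable_fibreLine (I := I) q β 0).hasMFDerivAt
  have h3 : HasMFDerivAt 𝓘(ℝ, ℝ) I
      ((TotalSpace.proj : TotalSpace F V → M) ∘ fibreLine q β) (0 : ℝ) 0 :=
    hasMFDerivAt_const q.proj (0 : ℝ)
  exact congrArg (fun L => L (1 : ℝ)) (hasMFDerivAt_unique h2 h3)

theorem projVec_horizontalLift (q : TotalSpace F V) (X : TangentSpace I q.proj) :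
    projVec I q (horizontalLift nablaV q X) = X := by
  have hs : MDifferentiableAt I (I.prod 𝓘(ℝ, F))
      (fun y => TotalSpace.mk' F y (extend F q.2 y)) q.proj :=
    mdifferentiableAt_extend I F q.2
  have h1 : HasMFDerivAt (I.prod 𝓘(ℝ, F)) I (TotalSpace.proj : TotalSpace F V → M)
      (TotalSpace.mk' F q.proj (extend F q.2 q.proj)) (projVec I q) := by
    rw [extend_apply_self]; exact (mdifferentiable_proj V q).hasMFDerivAt
  have h2 := h1.comp q.proj hs.hasMFDerivAt
  have h3 : HasMFDerivAt I I ((TotalSpace.proj : TotalSpace F V → M) ∘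
      fun y => TotalSpace.mk' F y (extend F q.2 y)) q.proj
      (ContinuousLinearMap.id ℝ (TangentSpace I q.proj)) :=
    hasMFDerivAt_id q.proj
  have h4 := congrArg (fun L => L X) (hasMFDerivAt_unique h2 h3)
  simp only [horizontalLift, LinearMap.sub_apply, map_sub, LinearMap.comp_apply,
    projVec_verticalLift, sub_zero]
  exact h4

theorem verticalLift_injective (q : TotalSpace F V) :
    Function.Injective (verticalLift I q) := by
  rw [injective_iff_map_eq_zero]
  intro β hβ
  have hΦ : MDifferentiableAt (I.prod 𝓘(ℝ, F)) 𝓘(ℝ, F)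
      (fun z : TotalSpace F V => (trivializationAt F V q.proj z).2)
      (fibreIncl q.proj (fibreCoord F q.proj q.2)) :=
    ((mdifferentiableAt_totalSpace I (fun z : TotalSpace F V => z)
      (x₀ := fibreIncl q.proj (fibreCoord F q.proj q.2))).1 mdifferentiableAt_id).2
  have h2 := hΦ.hasMFDerivAt.comp (fibreCoord F q.proj q.2)
    (mdifferentiable_fibreIncl I q.proj (fibreCoord F q.proj q.2)).hasMFDerivAt
  have h3 : HasMFDerivAt 𝓘(ℝ, F) 𝓘(ℝ, F)
      ((fun z : TotalSpace F V => (trivializationAt F V q.proj z).2) ∘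
        fibreIncl q.proj) (fibreCoord F q.proj q.2) (ContinuousLinearMap.id ℝ F) := by
    have : ((fun z : TotalSpace F V => (trivializationAt F V q.proj z).2) ∘
        fibreIncl q.proj) = id := funext fun g => trivializationAt_fibreIncl q.proj g
    rw [this]
    exact hasMFDerivAt_id _
  have h4 := congrArg (fun L => L (fibreCoord F q.proj β)) (hasMFDerivAt_unique h2 h3)
  have h5 : mfderiv 𝓘(ℝ, F) (I.prod 𝓘(ℝ, F)) (fibreIncl (F := F) (V := V) q.proj)
      (fibreCoord F q.proj q.2) (fibreCoord F q.proj β) = 0 := (verticalVector_eq q β).symm.trans hβ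
  have h6 : fibreCoord F q.proj β = 0 := by
    rw [← show _ = fibreCoord F q.proj β from h4]
    exact (congrArg (mfderiv (I.prod 𝓘(ℝ, F)) 𝓘(ℝ, F)
      (fun z : TotalSpace F V => (trivializationAt F V q.proj z).2)
      (fibreIncl q.proj (fibreCoord F q.proj q.2))) h5).trans (ContinuousLinearMap.map_zero _)
  simpa using h6

/-- The map `(X, β) ↦ X^h + β^v`. -/
def splittingMap (q : TotalSpace F V) :
    (TangentSpace I q.proj × V q.proj) →ₗ[ℝ] TangentSpace (I.prod 𝓘(ℝ, F)) q :=
  (horizontalLift nablaV q).coprod (verticalLift I q)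

theorem splittingMap_injective (q : TotalSpace F V) :
    Function.Injective (splittingMap nablaV q) := by
  rw [injective_iff_map_eq_zero]
  rintro ⟨X, β⟩ h
  simp only [splittingMap, LinearMap.coprod_apply] at h
  have hX : X = 0 := by
    have := congrArg (projVec I q) h
    rwa [map_add, projVec_horizontalLift, projVec_verticalLift, add_zero, map_zero] at this
  subst hX
  rw [map_zero, zero_add] at h
  have : β = 0 := verticalLift_injective q (h.trans (map_zero _).symm)
  rw [this]; rfl

/-- The isomorphism `(X, β) ↦ X^h + β^v`, that is, the splitting of the tangent space of the
total space at `q` into horizontal and vertical vectors. -/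
def tangentSplitting (q : TotalSpace F V) :
    (TangentSpace I q.proj × V q.proj) ≃ₗ[ℝ] TangentSpace (I.prod 𝓘(ℝ, F)) q :=
  haveI : FiniteDimensional ℝ (TangentSpace I q.proj × V q.proj) :=
    LinearEquiv.finiteDimensional (LinearEquiv.prodCongr (LinearEquiv.refl ℝ E)
      (fibreCoord F q.proj).symm.toLinearEquiv)
  haveI : FiniteDimensional ℝ (TangentSpace (I.prod 𝓘(ℝ, F)) q) :=
    inferInstanceAs (FiniteDimensional ℝ (E × F))
  LinearEquiv.ofInjectiveOfFinrankEq (splittingMap nablaV q) (splittingMap_injective nablaV q)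
    (LinearEquiv.finrank_eq (LinearEquiv.prodCongr (LinearEquiv.refl ℝ E)
      (fibreCoord F q.proj).toLinearEquiv))

theorem tangentSplitting_apply (q : TotalSpace F V) (X : TangentSpace I q.proj) (β : V q.proj) :
    tangentSplitting nablaV q (X, β) = horizontalLift nablaV q X + verticalLift I q β :=
  rfl

/-- The endomorphism `X^h + β^v ↦ (A X)^h + (B β)^v` of the tangent space of the total space. -/
def splittingEnd (q : TotalSpace F V) (A : TangentSpace I q.proj →ₗ[ℝ] TangentSpace I q.proj)
    (B : V q.proj →ₗ[ℝ] V q.proj) :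
    TangentSpace (I.prod 𝓘(ℝ, F)) q →ₗ[ℝ] TangentSpace (I.prod 𝓘(ℝ, F)) q :=
  (tangentSplitting nablaV q).toLinearMap ∘ₗ A.prodMap B ∘ₗ
    (tangentSplitting nablaV q).symm.toLinearMap

theorem splittingEnd_apply (q : TotalSpace F V)
    (A : TangentSpace I q.proj →ₗ[ℝ] TangentSpace I q.proj) (B : V q.proj →ₗ[ℝ] V q.proj)
    (X : TangentSpace I q.proj) (β : V q.proj) :
    splittingEnd nablaV q A B (horizontalLift nablaV q X + verticalLift I q β) =
      horizontalLift nablaV q (A X) + verticalLift I q (B β) := by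
  rw [← tangentSplitting_apply, ← tangentSplitting_apply]
  simp [splittingEnd]

/-- The space of the vectors `X^h + β^v` with `β` in a given subspace of the fibre. -/
def splittingSubspace (q : TotalSpace F V) (S : Submodule ℝ (V q.proj)) :
    Submodule ℝ (TangentSpace (I.prod 𝓘(ℝ, F)) q) :=
  LinearMap.range (horizontalLift nablaV q) ⊔ S.map (verticalLift I q)

end VectorBundleSplitting

/-! ### Densities -/

/-- The model space of 4-manifolds. -/
abbrev E4 : Type := EuclideanSpace ℝ (Fin 4)

section Manifold4

variable (M : Type*) [TopologicalSpace M] [ChartedSpace E4 M] [IsManifold (𝓡 4) ∞ M]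


theorem contDiff_clm_det : ContDiff ℝ ∞ (fun A : E4 →L[ℝ] E4 => A.det) := by
  have h : (fun A : E4 →L[ℝ] E4 => A.det) = fun A : E4 →L[ℝ] E4 =>
      ∑ σ : Equiv.Perm (Fin 4), ((Equiv.Perm.sign σ : ℤ) : ℝ) *
        ∏ i, (A (EuclideanSpace.single i 1)) (σ i) := by
    funext A
    have : A.det = LinearMap.det (A : E4 →ₗ[ℝ] E4) := rfl
    rw [this, ← LinearMap.det_toMatrix (EuclideanSpace.basisFun (Fin 4) ℝ).toBasis,
      Matrix.det_apply']
    simp [LinearMap.toMatrix_apply]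
  rw [h]
  fun_prop

theorem tangentCore_det_mul (i j k : atlas E4 M) {x : M}
    (hx : x ∈ i.1.source ∩ j.1.source ∩ k.1.source) :
    ((tangentBundleCore (𝓡 4) M).coordChange j k x).det *
      ((tangentBundleCore (𝓡 4) M).coordChange i j x).det =
      ((tangentBundleCore (𝓡 4) M).coordChange i k x).det := by
  have h : ((tangentBundleCore (𝓡 4) M).coordChange i k x : E4 →ₗ[ℝ] E4) =
      ((tangentBundleCore (𝓡 4) M).coordChange j k x : E4 →ₗ[ℝ] E4) ∘ₗ
        ((tangentBundleCore (𝓡 4) M).coordChange i j x : E4 →ₗ[ℝ] E4) :=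
    LinearMap.ext fun v => ((tangentBundleCore (𝓡 4) M).coordChange_comp i j k x hx v).symm
  simp only [ContinuousLinearMap.det, h, LinearMap.det_comp]

theorem tangentCore_det_self (i : atlas E4 M) {x : M} (hx : x ∈ i.1.source) :
    ((tangentBundleCore (𝓡 4) M).coordChange i i x).det = 1 := by
  have h : ((tangentBundleCore (𝓡 4) M).coordChange i i x : E4 →ₗ[ℝ] E4) = LinearMap.id :=
    LinearMap.ext fun v => (tangentBundleCore (𝓡 4) M).coordChange_self i x hx v
  simp only [ContinuousLinearMap.det, h, LinearMap.det_id]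

theorem tangentCore_det_ne_zero (i j : atlas E4 M) {x : M}
    (hx : x ∈ i.1.source ∩ j.1.source) :
    ((tangentBundleCore (𝓡 4) M).coordChange i j x).det ≠ 0 := by
  have h := tangentCore_det_mul M i j i ⟨hx, hx.1⟩
  rw [tangentCore_det_self M i hx.1] at h
  exact right_ne_zero_of_mul_eq_one h

theorem contMDiffOn_densityChange (w : ℝ) (i j : atlas E4 M) :
    ContMDiffOn (𝓡 4) 𝓘(ℝ, ℝ →L[ℝ] ℝ) ∞
      (fun x : M => (|((tangentBundleCore (𝓡 4) M).coordChange i j x).det| ^ (w / 4)) •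
        ContinuousLinearMap.id ℝ ℝ) (i.1.source ∩ j.1.source) := by
  intro x hx
  have : (tangentBundleCore (𝓡 4) M).IsContMDiff (𝓡 4) ∞ :=
    tangentBundleCore.isContMDiff (h := ‹IsManifold (𝓡 4) ∞ M›)
  have h1 : ContMDiffWithinAt (𝓡 4) 𝓘(ℝ, E4 →L[ℝ] E4) ∞
      ((tangentBundleCore (𝓡 4) M).coordChange i j) (i.1.source ∩ j.1.source) x :=
    (tangentBundleCore (𝓡 4) M).contMDiffOn_coordChange (n := ∞) (𝓡 4) i j x hx
  have h2 : ContDiffAt ℝ ∞ (fun A : E4 →L[ℝ] E4 =>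
      (|A.det| ^ (w / 4)) • ContinuousLinearMap.id ℝ ℝ)
      ((tangentBundleCore (𝓡 4) M).coordChange i j x) := by
    have h3 := tangentCore_det_ne_zero M i j hx
    exact (((contDiffAt_abs h3).comp _ contDiff_clm_det.contDiffAt).rpow_const_of_ne
      (by simpa using h3)).smul contDiffAt_const
  exact h2.contMDiffAt.comp_contMDiffWithinAt x h1

/-- The vector bundle core of the weight `w` density bundle `L^w`, `L = |Λ⁴TM|^(1/4)`: a density
is a real number in every chart, and these numbers change by the factor `|det A|^(w/4)`, where
`A` is the Jacobian of the change of charts. -/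
def densityCore (w : ℝ) : VectorBundleCore ℝ M ℝ (atlas E4 M) where
  baseSet i := i.1.source
  isOpen_baseSet i := i.1.open_source
  indexAt := achart E4
  mem_baseSet_at := mem_chart_source E4
  coordChange i j x :=
    (|((tangentBundleCore (𝓡 4) M).coordChange i j x).det| ^ (w / 4)) • ContinuousLinearMap.id ℝ ℝ
  coordChange_self i x hx v := by
    rw [tangentCore_det_self M i hx]; simp
  continuousOn_coordChange i j := (contMDiffOn_densityChange M w i j).continuousOn
  coordChange_comp i j k x hx v := by
    rw [← tangentCore_det_mul M i j k hx, abs_mul, Real.mul_rpow (abs_nonneg _) (abs_nonneg _)]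
    simp [mul_assoc]

instance densityCore_isContMDiff (w : ℝ) : (densityCore M w).IsContMDiff (𝓡 4) ∞ where
  contMDiffOn_coordChange i j := contMDiffOn_densityChange M w i j

variable {M}

/-- The line bundle `L^w` of densities of weight `w`. -/
def Density (w : ℝ) (x : M) : Type := (densityCore M w).Fiber x

section
variable (w : ℝ)

instance (x : M) : AddCommGroup (Density w x) := inferInstanceAs (AddCommGroup ℝ)
instance (x : M) : Module ℝ (Density w x) := inferInstanceAs (Module ℝ ℝ)
instance (x : M) : TopologicalSpace (Density w x) := inferInstanceAs (TopologicalSpace ℝ)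
instance (x : M) : IsTopologicalAddGroup (Density w x) :=
  inferInstanceAs (IsTopologicalAddGroup ℝ)
instance (x : M) : ContinuousSMul ℝ (Density w x) := inferInstanceAs (ContinuousSMul ℝ ℝ)
instance : TopologicalSpace (TotalSpace ℝ (Density (M := M) w)) :=
  inferInstanceAs (TopologicalSpace (TotalSpace ℝ (densityCore M w).Fiber))
instance : FiberBundle ℝ (Density (M := M) w) :=
  inferInstanceAs (FiberBundle ℝ (densityCore M w).Fiber)
instance : VectorBundle ℝ ℝ (Density (M := M) w) :=
  inferInstanceAs (VectorBundle ℝ ℝ (densityCore M w).Fiber)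
instance : ContMDiffVectorBundle ∞ ℝ (Density (M := M) w) (𝓡 4) :=
  inferInstanceAs (ContMDiffVectorBundle ∞ ℝ (densityCore M w).Fiber (𝓡 4))

end


/-- The model fibre of the bundle of bilinear forms. -/
abbrev BilinForm4 : Type := E4 →L[ℝ] E4 →L[ℝ] ℝ


/-- The bundle `L² ⊗ T*M ⊗ T*M` of bilinear forms on `TM` with values in `L²`. -/
abbrev WForm (x : M) : Type :=
  TangentSpace (𝓡 4) x →L[ℝ] TangentSpace (𝓡 4) x →L[ℝ] Density 2 x


/-- The product `L ⊗ L → L²` of densities at a point. -/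
def densityMul (x : M) : Density 1 x →L[ℝ] Density 1 x →L[ℝ] Density 2 x :=
  (ContinuousLinearMap.mul ℝ ℝ : ℝ →L[ℝ] ℝ →L[ℝ] ℝ)

/-- The coordinate of a density at `x` with respect to the density `|∂₁ ∧ ⋯ ∧ ∂₄|^(w/4)` of the
preferred chart at `x`. -/
def densityCoord {w : ℝ} {x : M} (a : Density w x) : ℝ := a

/-- The real number `a / b` for densities `a`, `b` of the same weight (`b ≠ 0`). -/
def densityRatio {w : ℝ} {x : M} (a b : Density w x) : ℝ := densityCoord a / densityCoord b

/-- The density `|∂₁ ∧ ⋯ ∧ ∂₄|^(w/4)` at `x` of the preferred chart at `x`. -/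
def densityUnit (w : ℝ) (x : M) : Density w x := (1 : ℝ)

/-- A local length scale near `x`, that is, a nowhere zero local section of `L`. -/
def localScale (x : M) : (y : M) → Density 1 y := extend ℝ (densityUnit 1 x)

theorem densityRatio_localScale_eventuallyEq (τ : (y : M) → Density 2 y) (x : M) :
    (fun y => densityRatio (τ y) (densityMul y (localScale x y) (localScale x y))) =ᶠ[𝓝 x]
      fun y => (trivializationAt ℝ (Density (M := M) 2) x ⟨y, τ y⟩).2 := by
  filter_upwards [(chartAt E4 x).open_source.mem_nhds (mem_chart_source E4 x)] with y hy
  have hd := tangentCore_det_ne_zero M (achart E4 y) (achart E4 x) (x := y)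
    ⟨mem_chart_source E4 y, hy⟩
  set d := ((tangentBundleCore (𝓡 4) M).coordChange (achart E4 y) (achart E4 x) y).det with hdd
  have hμ : |d| ^ ((1 : ℝ) / 4) * (densityCoord (localScale x y)) = 1 := by
    have h1 := (trivializationAt ℝ (Density (M := M) 1) x).apply_mk_symm (b := y) hy
      (trivializationAt ℝ (Density (M := M) 1) x ⟨x, densityUnit 1 x⟩).2
    have h2 := congrArg Prod.snd h1
    have h3 : (trivializationAt ℝ (Density (M := M) 1) x
        ⟨x, densityUnit 1 x⟩).2 = (1 : ℝ) :=
      (densityCore M 1).coordChange_self (achart E4 x) x (mem_chart_source E4 x) 1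
    exact h2.trans h3
  have hτ : (trivializationAt ℝ (Density (M := M) 2) x ⟨y, τ y⟩).2 =
      |d| ^ ((2 : ℝ) / 4) * (densityCoord (τ y)) := rfl
  have hr : |d| ^ ((2 : ℝ) / 4) = |d| ^ ((1 : ℝ) / 4) * |d| ^ ((1 : ℝ) / 4) := by
    rw [← Real.rpow_add (abs_pos.mpr hd)]; norm_num
  rw [hτ, hr]
  change (densityCoord (τ y)) / ((densityCoord (localScale x y)) * (densityCoord (localScale x y))) = _
  have h0 : (densityCoord (localScale x y)) ≠ 0 := right_ne_zero_of_mul_eq_one hμ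
  rw [div_eq_iff (mul_ne_zero h0 h0)]
  linear_combination (-(densityCoord (τ y))) *
    (|d| ^ ((1 : ℝ) / 4) * (densityCoord (localScale x y)) + 1) * hμ

theorem mdifferentiableAt_densityRatio {τ : (y : M) → Density 2 y} {x : M}
    (hτ : MDifferentiableAt (𝓡 4) ((𝓡 4).prod 𝓘(ℝ, ℝ)) (fun y => TotalSpace.mk' ℝ y (τ y)) x) :
    MDifferentiableAt (𝓡 4) 𝓘(ℝ, ℝ)
      (fun y => densityRatio (τ y) (densityMul y (localScale x y) (localScale x y))) x :=
  ((mdifferentiableAt_section (𝓡 4) τ).1 hτ).congr_of_eventuallyEq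
    (densityRatio_localScale_eventuallyEq τ x)

/-- The connection on `L²` induced by a connection `D` on `L`: writing `τ = h μ²` with a local
length scale `μ`, it is `D τ = dh μ² + 2 h μ D μ`. -/
def squareConnection (D : CovariantDerivative (𝓡 4) ℝ (Density (M := M) 1)) :
    CovariantDerivative (𝓡 4) ℝ (Density (M := M) 2) where
  toFun τ x :=
    (mvfderiv (𝓡 4) (fun y => densityRatio (τ y) (densityMul y (localScale x y) (localScale x y))) x).smulRight
        (densityMul x (localScale x x) (localScale x x)) +
      (2 * densityRatio (τ x) (densityMul x (localScale x x) (localScale x x))) •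
        (densityMul x (localScale x x)).comp (D (localScale x) x)
  isCovariantDerivativeOnUniv := by
    constructor
    · intro σ σ' x hσ hσ' _
      have h : (fun y => densityRatio ((σ + σ') y)
          (densityMul y (localScale x y) (localScale x y))) =
          (fun y => densityRatio (σ y) (densityMul y (localScale x y) (localScale x y))) +
          (fun y => densityRatio (σ' y) (densityMul y (localScale x y) (localScale x y))) := by
        funext y; exact add_div _ _ _
      rw [h, mvfderiv_add (mdifferentiableAt_densityRatio hσ) (mdifferentiableAt_densityRatio hσ'),
        congrFun h x]
      ext v
      simp
      module
    · intro σ g x hσ hg _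
      have h : (fun y => densityRatio ((g • σ) y)
          (densityMul y (localScale x y) (localScale x y))) =
          g • (fun y => densityRatio (σ y) (densityMul y (localScale x y) (localScale x y))) := by
        funext y; exact mul_div_assoc _ _ _
      have h1 : densityRatio (σ x) (densityMul x (localScale x x) (localScale x x)) •
          densityMul x (localScale x x) (localScale x x) = σ x := by
        have : localScale x x = densityUnit 1 x := extend_apply_self _ _
        rw [this]
        change (densityCoord (σ x)) / ((1 : ℝ) * 1) * ((1 : ℝ) * 1) = (densityCoord (σ x))
        ring
      rw [h, mvfderiv_smul hg (mdifferentiableAt_densityRatio hσ), congrFun h x]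
      have h2 : (mvfderiv (𝓡 4) g x).smulRight (σ x) = (mvfderiv (𝓡 4) g x).smulRight
          (densityRatio (σ x) (densityMul x (localScale x x) (localScale x x)) •
            densityMul x (localScale x x) (localScale x x)) := by rw [h1]
      rw [h2]
      ext v
      simp
      module

/-- `(∇_Z B)(X, Y) = D_Z (B(X, Y)) - B(∇_Z X, Y) - B(X, ∇_Z Y)` at `x`. -/
def bilinCovAux (nabla : CovariantDerivative (𝓡 4) E4 (TangentSpace (𝓡 4) : M → Type))
    (D : CovariantDerivative (𝓡 4) ℝ (Density (M := M) 1)) (B : (y : M) → WForm y) (x : M)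
    (Z : TangentSpace (𝓡 4) x) (X Y : (y : M) → TangentSpace (𝓡 4) y) : Density 2 x :=
  squareConnection D (fun y => B y (X y) (Y y)) x Z
    - B x (nabla X x Z) (Y x) - B x (X x) (nabla Y x Z)

/-- Differentiability at a point of an `L²`-valued bilinear form. -/
abbrev MDiffForm (B : (y : M) → WForm y) (x : M) : Prop :=
  MDifferentiableAt (𝓡 4) ((𝓡 4).prod 𝓘(ℝ, BilinForm4))
    (fun y => TotalSpace.mk' BilinForm4 y (B y)) x

/-- Differentiability at a point of a vector field. -/
abbrev MDiffField (X : (y : M) → TangentSpace (𝓡 4) y) (x : M) : Prop :=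
  MDifferentiableAt (𝓡 4) ((𝓡 4).prod 𝓘(ℝ, E4)) (fun y => TotalSpace.mk' E4 y (X y)) x

variable (nabla : CovariantDerivative (𝓡 4) E4 (TangentSpace (𝓡 4) : M → Type))
    (D : CovariantDerivative (𝓡 4) ℝ (Density (M := M) 1))

theorem bilinCovAux_tensorial_left {B : (y : M) → WForm y} {x : M} (hB : MDiffForm B x)
    (Z : TangentSpace (𝓡 4) x) (Y : (y : M) → TangentSpace (𝓡 4) y) (hY : MDiffField Y x) :
    TensorialAt (𝓡 4) E4 (fun X => bilinCovAux nabla D B x Z X Y) x where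
  smul {f X} hf hX := by
    have h1 : (fun y => B y ((f • X) y) (Y y)) = f • fun y => B y (X y) (Y y) := by
      funext y; simp
    have h2 := (squareConnection D).isCovariantDerivativeOnUniv.leibniz
      (hB.clm_bundle_apply₂ hX hY) hf
    have h3 := nabla.isCovariantDerivativeOnUniv.leibniz hX hf
    simp only [bilinCovAux, h1]
    rw [h2, h3]
    simp
    module
  add {X X'} hX hX' := by
    have h1 : (fun y => B y ((X + X') y) (Y y)) =
        (fun y => B y (X y) (Y y)) + fun y => B y (X' y) (Y y) := by
      funext y; simp
    have h2 := (squareConnection D).isCovariantDerivativeOnUniv.add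
      (hB.clm_bundle_apply₂ hX hY) (hB.clm_bundle_apply₂ hX' hY)
    have h3 := nabla.isCovariantDerivativeOnUniv.add hX hX'
    simp only [bilinCovAux, h1]
    rw [h2, h3]
    simp
    abel

theorem bilinCovAux_tensorial_right {B : (y : M) → WForm y} {x : M} (hB : MDiffForm B x)
    (Z : TangentSpace (𝓡 4) x) (X : (y : M) → TangentSpace (𝓡 4) y) (hX : MDiffField X x) :
    TensorialAt (𝓡 4) E4 (fun Y => bilinCovAux nabla D B x Z X Y) x where
  smul {f Y} hf hY := by
    have h1 : (fun y => B y (X y) ((f • Y) y)) = f • fun y => B y (X y) (Y y) := by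
      funext y; simp
    have h2 := (squareConnection D).isCovariantDerivativeOnUniv.leibniz
      (hB.clm_bundle_apply₂ hX hY) hf
    have h3 := nabla.isCovariantDerivativeOnUniv.leibniz hY hf
    simp only [bilinCovAux, h1]
    rw [h2, h3]
    simp
    module
  add {Y Y'} hY hY' := by
    have h1 : (fun y => B y (X y) ((Y + Y') y)) =
        (fun y => B y (X y) (Y y)) + fun y => B y (X y) (Y' y) := by
      funext y; simp
    have h2 := (squareConnection D).isCovariantDerivativeOnUniv.add
      (hB.clm_bundle_apply₂ hX hY) (hB.clm_bundle_apply₂ hX hY')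
    have h3 := nabla.isCovariantDerivativeOnUniv.add hY hY'
    simp only [bilinCovAux, h1]
    rw [h2, h3]
    simp
    abel

open scoped Classical in
/-- The covariant derivative `Z ↦ ∇_Z B` at `x` of an `L²`-valued bilinear form, induced by a
connection on `TM` and a connection on `L` (and `0` where `B` is not differentiable). -/
def bilinCov (B : (y : M) → WForm y) (x : M) : TangentSpace (𝓡 4) x →ₗ[ℝ] WForm x :=
  if hB : MDiffForm B x then
    { toFun := fun Z => TensorialAt.mkHom₂ (bilinCovAux nabla D B x Z) x
        (fun Y hY => bilinCovAux_tensorial_left nabla D hB Z Y hY)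
        (fun X hX => bilinCovAux_tensorial_right nabla D hB Z X hX)
      map_add' := fun Z Z' => by
        ext X Y
        simp only [add_apply, TensorialAt.mkHom₂_apply_eq_extend, bilinCovAux,
          map_add]
        abel
      map_smul' := fun a Z => by
        ext X Y
        simp only [smul_apply, TensorialAt.mkHom₂_apply_eq_extend, bilinCovAux,
          map_smul, RingHom.id_apply]
        module }
  else 0

/-! ### Conformal metrics, almost complex structures and Weyl connections -/

/-- The coordinate vector field `∂ᵢ` of the preferred chart at `x`, at the point `x`. -/
def coordVector (x : M) (i : Fin 4) : TangentSpace (𝓡 4) x := EuclideanSpace.single i (1 : ℝ)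

variable (M) in
/-- A smooth conformal metric: a metric on `TM` with values in `L²`, normalized by
`|det c| = 1`. Here `det (c(∂ᵢ, ∂ⱼ))` is a density of weight 8, compared with
`|∂₁ ∧ ⋯ ∧ ∂₄|²`. -/
structure ConformalMetric where
  form : (x : M) → WForm x
  symm : ∀ (x : M) (v w : TangentSpace (𝓡 4) x), form x v w = form x w v
  pos : ∀ (x : M) (v : TangentSpace (𝓡 4) x), v ≠ 0 → 0 < densityCoord (form x v v)
  normalized : ∀ x : M, |(Matrix.of fun i j : Fin 4 =>
    densityCoord (form x (coordVector x i) (coordVector x j))).det| = 1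
  smooth : ContMDiff (𝓡 4) ((𝓡 4).prod 𝓘(ℝ, BilinForm4)) ∞
    (fun x => TotalSpace.mk' BilinForm4 x (form x))

variable (M) in
/-- A smooth almost complex structure. -/
structure AlmostComplexStructure where
  toFun : (x : M) → TangentSpace (𝓡 4) x →L[ℝ] TangentSpace (𝓡 4) x
  sq : ∀ (x : M) (v : TangentSpace (𝓡 4) x), toFun x (toFun x v) = -v
  smooth : ContMDiff (𝓡 4) ((𝓡 4).prod 𝓘(ℝ, E4 →L[ℝ] E4)) ∞
    (fun x => TotalSpace.mk' (E4 →L[ℝ] E4)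
      (E := fun x : M => TangentSpace (𝓡 4) x →L[ℝ] TangentSpace (𝓡 4) x) x (toFun x))

/-- `(M, c, J)` is conformally almost-Hermitian. -/
def IsConformallyAlmostHermitian (c : ConformalMetric M) (J : AlmostComplexStructure M) : Prop :=
  ∀ (x : M) (v w : TangentSpace (𝓡 4) x),
    c.form x v w = c.form x (J.toFun x v) (J.toFun x w)

/-- The conformal Kähler form `ω_c = c(J·, ·)`. -/
def kaehlerForm (c : ConformalMetric M) (J : AlmostComplexStructure M) (x : M) : WForm x :=
  (c.form x).comp (J.toFun x)

/-- The exterior covariant derivative `(d^D B)(X, Y, Z)` at `x` of an `L²`-valued 2-form `B`. -/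
def extCov (D : CovariantDerivative (𝓡 4) ℝ (Density (M := M) 1)) (B : (y : M) → WForm y)
    (X Y Z : (y : M) → TangentSpace (𝓡 4) y) (x : M) : Density 2 x :=
  squareConnection D (fun y => B y (Y y) (Z y)) x (X x)
    - squareConnection D (fun y => B y (X y) (Z y)) x (Y x)
    + squareConnection D (fun y => B y (X y) (Y y)) x (Z x)
    - B x (VectorField.mlieBracket (𝓡 4) X Y x) (Z x)
    + B x (VectorField.mlieBracket (𝓡 4) X Z x) (Y x)
    - B x (VectorField.mlieBracket (𝓡 4) Y Z x) (X x)

/-- `D` is the canonical Weyl derivative of `(M, c, J)`: `d^D ω_c = 0`. -/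
def IsCanonicalWeylDerivative (c : ConformalMetric M) (J : AlmostComplexStructure M)
    (D : CovariantDerivative (𝓡 4) ℝ (Density (M := M) 1)) : Prop :=
  ∀ (x : M) (X Y Z : (y : M) → TangentSpace (𝓡 4) y),
    MDiffField X x → MDiffField Y x → MDiffField Z x → extCov D (kaehlerForm c J) X Y Z x = 0

/-- `nabla` is the Weyl connection `∇^D` of `(M, c, D)`: it is torsion free and `c` is parallel. -/
def IsWeylConnection (c : ConformalMetric M)
    (D : CovariantDerivative (𝓡 4) ℝ (Density (M := M) 1))
    (nabla : CovariantDerivative (𝓡 4) E4 (TangentSpace (𝓡 4) : M → Type)) : Prop :=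
  nabla.torsion = 0 ∧ ∀ x : M, bilinCov nabla D c.form x = 0

/-- The orientation `o` of `M` is the one given by `J`: frames `(u, Ju, v, Jv)` are positive. -/
def IsComplexOrientation (J : AlmostComplexStructure M)
    (o : (x : M) → Orientation ℝ (TangentSpace (𝓡 4) x) (Fin 4)) : Prop :=
  ∀ (x : M) (b : Module.Basis (Fin 4) ℝ (TangentSpace (𝓡 4) x)),
    b 1 = J.toFun x (b 0) → b 3 = J.toFun x (b 2) → b.orientation = o x

/-! ### The weightless twistor space -/

variable (M) in
/-- The total space of `L² ⊗ T*M ⊗ T*M`. -/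
abbrev FormTotal := TotalSpace BilinForm4 (WForm (M := M))

/-- The model with corners of the total space. -/
abbrev FormModel : ModelWithCorners ℝ (E4 × BilinForm4) (ModelProd E4 BilinForm4) :=
  (𝓡 4).prod 𝓘(ℝ, BilinForm4)

/-- `β` is an `L²`-valued 2-form at `x`. -/
def IsTwoForm {x : M} (β : WForm x) : Prop := ∀ v : TangentSpace (𝓡 4) x, β v v = 0

/-- `e` is a positively oriented frame at `x` with `c(eᵢ, eⱼ) = δᵢⱼ m`. -/
structure IsConformalFrame (c : ConformalMetric M)
    (o : (x : M) → Orientation ℝ (TangentSpace (𝓡 4) x) (Fin 4)) (x : M)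
    (e : Module.Basis (Fin 4) ℝ (TangentSpace (𝓡 4) x)) (m : Density 2 x) : Prop where
  orthogonal : ∀ i j : Fin 4, c.form x (e i) (e j) = if i = j then m else 0
  positive : e.orientation = o x

/-- The weightless components `β(eᵢ, eⱼ) / m` of an `L²`-valued 2-form. -/
def frameCoeff {x : M} (e : Module.Basis (Fin 4) ℝ (TangentSpace (𝓡 4) x)) (m : Density 2 x)
    (β : WForm x) (i j : Fin 4) : ℝ := densityRatio (β (e i) (e j)) m

/-- The inner product `c(β, γ)` of `L²`-valued 2-forms, computed in a conformal frame. -/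
def formInner {x : M} (e : Module.Basis (Fin 4) ℝ (TangentSpace (𝓡 4) x)) (m : Density 2 x)
    (β γ : WForm x) : ℝ :=
  ∑ i : Fin 4, ∑ j ∈ Finset.Ioi i, frameCoeff e m β i j * frameCoeff e m γ i j

/-- The number `t` with `β ∧ γ = t ν_c`, where `ν_c(e₀, e₁, e₂, e₃) = m²` for positively oriented
conformal frames. -/
def formWedge {x : M} (e : Module.Basis (Fin 4) ℝ (TangentSpace (𝓡 4) x)) (m : Density 2 x)
    (β γ : WForm x) : ℝ :=
  frameCoeff e m β 0 1 * frameCoeff e m γ 2 3 - frameCoeff e m β 0 2 * frameCoeff e m γ 1 3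
    + frameCoeff e m β 0 3 * frameCoeff e m γ 1 2 + frameCoeff e m β 1 2 * frameCoeff e m γ 0 3
    - frameCoeff e m β 1 3 * frameCoeff e m γ 0 2 + frameCoeff e m β 2 3 * frameCoeff e m γ 0 1

/-- `⋆γ = γ` for the conformal Hodge star, `β ∧ ⋆γ = c(β, γ) ν_c`. -/
def IsSelfDual (c : ConformalMetric M)
    (o : (x : M) → Orientation ℝ (TangentSpace (𝓡 4) x) (Fin 4)) {x : M} (γ : WForm x) : Prop :=
  ∀ e m, IsConformalFrame c o x e m → ∀ β : WForm x, IsTwoForm β →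
    formWedge e m β γ = formInner e m β γ

/-- The weightless twistor space `Z_+ = S(L² Λ²_+ T*M)`. The radius of the spheres is `√2` for the
inner product in which the `eⁱ ∧ eʲ` are orthonormal, the norm of `c(J·, ·)` for an orthogonal
complex structure `J`. -/
def twistorSpacePlus (c : ConformalMetric M)
    (o : (x : M) → Orientation ℝ (TangentSpace (𝓡 4) x) (Fin 4)) : Set (FormTotal M) :=
  {q | IsTwoForm q.2 ∧ IsSelfDual c o q.2 ∧
    ∀ e m, IsConformalFrame c o q.proj e m → formInner e m q.2 q.2 = 2}

/-- The endomorphism `J_q` of the tangent space with `q(X, Y) = c(J_q X, Y)`. -/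
def endoOfForm (c : ConformalMetric M) (q : FormTotal M) :
    TangentSpace (𝓡 4) q.proj →L[ℝ] TangentSpace (𝓡 4) q.proj :=
  (c.form q.proj).inverse.comp q.2

/-- The action `(A β)(X, Y) = β(A X, Y)` of an endomorphism on bilinear forms. -/
def formAct {x : M} (A : TangentSpace (𝓡 4) x →L[ℝ] TangentSpace (𝓡 4) x) :
    WForm x →ₗ[ℝ] WForm x where
  toFun β := β.comp A
  map_add' _ _ := rfl
  map_smul' _ _ := rfl

/-- The `L²`-valued 2-forms that are anti-invariant under `J_q`. -/
def antiInvariantForms (c : ConformalMetric M) (q : FormTotal M) :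
    Submodule ℝ (WForm q.proj) where
  carrier := {β | IsTwoForm β ∧ ∀ v w : TangentSpace (𝓡 4) q.proj,
    β (endoOfForm c q v) (endoOfForm c q w) = -β v w}
  add_mem' := by
    rintro β β' ⟨h1, h2⟩ ⟨h1', h2'⟩
    refine ⟨fun v => ?_, fun v w => ?_⟩
    · simp [h1 v, h1' v]
    · simp only [add_apply, h2, h2']; abel
  zero_mem' := ⟨fun v => by simp, fun v w => by simp⟩
  smul_mem' := by
    rintro a β ⟨h1, h2⟩
    refine ⟨fun v => ?_, fun v w => ?_⟩
    · simp [h1 v]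
    · simp only [smul_apply, h2, smul_neg]

/-- The tangent space at `q` of the twistor space, inside the tangent space of the total space of
`L² ⊗ T*M ⊗ T*M`: the vectors `X^h + β^v` with `β` anti-invariant under `J_q`. -/
def twistorTangent (c : ConformalMetric M)
    (D : CovariantDerivative (𝓡 4) ℝ (Density (M := M) 1))
    (nabla : CovariantDerivative (𝓡 4) E4 (TangentSpace (𝓡 4) : M → Type)) (q : FormTotal M) :
    Submodule ℝ (TangentSpace FormModel q) :=
  splittingSubspace (bilinCov nabla D) q (antiInvariantForms c q)

/-- The almost complex structure `𝒥_+`: `X^h + β^v ↦ (J_q X)^h + (J_q β)^v`. -/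
def twistorJ (c : ConformalMetric M)
    (D : CovariantDerivative (𝓡 4) ℝ (Density (M := M) 1))
    (nabla : CovariantDerivative (𝓡 4) E4 (TangentSpace (𝓡 4) : M → Type)) (q : FormTotal M) :
    TangentSpace FormModel q →ₗ[ℝ] TangentSpace FormModel q :=
  splittingEnd (bilinCov nabla D) q (endoOfForm c q).toLinearMap (formAct (endoOfForm c q))

/-- The section of the bundle `L² ⊗ T*M ⊗ T*M` given by `ω_c`. -/
def kaehlerSection (c : ConformalMetric M) (J : AlmostComplexStructure M) (x : M) : FormTotal M :=
  ⟨x, kaehlerForm c J x⟩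

/-- The differential of that section. -/
def kaehlerSectionDeriv (c : ConformalMetric M) (J : AlmostComplexStructure M) (x : M) :
    TangentSpace (𝓡 4) x →L[ℝ] TangentSpace FormModel (kaehlerSection c J x) :=
  mfderiv (𝓡 4) FormModel (kaehlerSection c J) x

end Manifold4

end

end WeylTwistor

/-! For every differentiable section `B` of the bundle of `L²`-valued bilinear forms, `dB(Z) = Z^h +
(∇_Z B)^v` (`mfderiv_form_section`). At `q = ω_c` the endomorphism `J_q` is `J`, because `c` is
nondegenerate (`endoOfForm_kaehlerSection`). Hence `ds(Z)` is tangent to the twistor space as soon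
as `∇_Z ω_c` is a `J`-anti-invariant 2-form, and the section is holomorphic as soon as `∇_{JZ} ω_c =
J(∇_Z ω_c)`.

Since `∇c = 0`, one has `∇_Z ω_c = c((∇_Z J)·, ·)`. Differentiating `J² = -1` shows that `∇_Z J`
anticommutes with `J`, and `J` is `c`-orthogonal, so `∇_Z ω_c` is anti-invariant
(`bilinCov_kaehlerForm_antiInvariant`). As `∇^D` is torsion free, `d^D ω_c = 0` says that the cyclic
sum of `∇ω_c` vanishes (`bilinCov_kaehlerForm_cyclic`). Four instances of this identity, with `J`
inserted in various slots, combine with anti-invariance to give `∇_{JZ} ω_c = J(∇_Z ω_c)`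
(`bilinCov_kaehlerForm_J`).

That `ω_c` lies in the twistor space is linear algebra: in a conformal frame its matrix is skew with
square `-1`, hence self-dual or anti-self-dual, and the orientation given by `J` excludes the latter
(`selfDual_of_orthogonal_complex`). -/

namespace WeylTwistor

/-! ### The differential of a section of a vector bundle -/

section VectorBundleSplitting

set_option linter.unusedSectionVars false

variable {E : Type*} [NormedAddCommGroup E] [NormedSpace ℝ E] [FiniteDimensional ℝ E]
  {H : Type*} [TopologicalSpace H] {I : ModelWithCorners ℝ E H}
  {M : Type*} [TopologicalSpace M] [ChartedSpace H M]
  {F : Type*} [NormedAddCommGroup F] [NormedSpace ℝ F] [FiniteDimensional ℝ F]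
  {V : M → Type*} [TopologicalSpace (TotalSpace F V)]
  [∀ x, AddCommGroup (V x)] [∀ x, Module ℝ (V x)] [∀ x, TopologicalSpace (V x)]
  [FiberBundle F V] [VectorBundle ℝ F V] [IsManifold I 1 M] [ContMDiffVectorBundle 1 F V I]

variable (I) in
/-- The differential at `q` of the fibre coordinate of the trivialization over `π q`. -/
noncomputable def fibreCoordDeriv (q : TotalSpace F V) :
    TangentSpace (I.prod 𝓘(ℝ, F)) q →L[ℝ] F :=
  mfderiv (I.prod 𝓘(ℝ, F)) 𝓘(ℝ, F)
    (fun z : TotalSpace F V => (trivializationAt F V q.proj z).2) q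

theorem hasMFDerivAt_fibreCoord (q : TotalSpace F V) :
    HasMFDerivAt (I.prod 𝓘(ℝ, F)) 𝓘(ℝ, F)
      (fun z : TotalSpace F V => (trivializationAt F V q.proj z).2) q (fibreCoordDeriv I q) :=
  ((mdifferentiableAt_totalSpace I (fun z : TotalSpace F V => z)).1
    mdifferentiableAt_id).2.hasMFDerivAt

/-- In the trivialization the line `q + tβ` is affine in `t`, with slope the coordinate of `β`. -/
theorem fibreCoordDeriv_verticalLift (q : TotalSpace F V) (β : V q.proj) :
    fibreCoordDeriv I q (verticalLift I q β) = fibreCoord F q.proj β := by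
  have h1 : HasMFDerivAt (I.prod 𝓘(ℝ, F)) 𝓘(ℝ, F)
      (fun z : TotalSpace F V => (trivializationAt F V q.proj z).2) (fibreLine q β 0)
      (fibreCoordDeriv I q) := by
    rw [fibreLine_zero]; exact hasMFDerivAt_fibreCoord q
  have h2 := h1.comp (0 : ℝ) (mdifferentiable_fibreLine (I := I) q β 0).hasMFDerivAt
  have h3 : HasDerivAt (fun t : ℝ => fibreCoord F q.proj q.2 + t • fibreCoord F q.proj β)
      (fibreCoord F q.proj β) 0 := by
    simpa using ((hasDerivAt_id (0 : ℝ)).smul_const (fibreCoord F q.proj β)).const_add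
      (fibreCoord F q.proj q.2)
  have h4 := h3.hasFDerivAt.hasMFDerivAt
  have h5 : ((fun z : TotalSpace F V => (trivializationAt F V q.proj z).2) ∘ fibreLine q β) =
      fun t : ℝ => fibreCoord F q.proj q.2 + t • fibreCoord F q.proj β := by
    rw [fibreLine_eq]
    funext t
    exact trivializationAt_fibreIncl _ _
  rw [h5] at h2
  exact (congrArg (fun L => L (1 : ℝ)) (hasMFDerivAt_unique h2 h4)).trans (one_smul ℝ _)

/-- The point `q` is tied to `s x` by an equation so that the lemma also applies to `extend F (s
x)`, whose value at `x` is `s x` only propositionally. -/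
theorem fibreCoordDeriv_mfderiv_section {s : (y : M) → V y} {x : M}
    (hs : MDifferentiableAt I (I.prod 𝓘(ℝ, F)) (fun y => TotalSpace.mk' F y (s y)) x)
    (q : TotalSpace F V) (hq : TotalSpace.mk' F x (s x) = q) (Z : TangentSpace I x) :
    fibreCoordDeriv I q (mfderiv I (I.prod 𝓘(ℝ, F)) (fun y => TotalSpace.mk' F y (s y)) x Z) =
      mvfderiv I (fun y => (trivializationAt F V x ⟨y, s y⟩).2) x Z := by
  subst hq
  exact congrArg (fun L => L Z)
    ((hasMFDerivAt_fibreCoord (TotalSpace.mk' F x (s x))).comp x hs.hasMFDerivAt).mfderiv.symm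

theorem projVec_mfderiv_section {s : (y : M) → V y} {x : M}
    (hs : MDifferentiableAt I (I.prod 𝓘(ℝ, F)) (fun y => TotalSpace.mk' F y (s y)) x)
    (Z : TangentSpace I x) :
    projVec I (TotalSpace.mk' F x (s x))
      (mfderiv I (I.prod 𝓘(ℝ, F)) (fun y => TotalSpace.mk' F y (s y)) x Z) = Z := by
  have h1 : HasMFDerivAt (I.prod 𝓘(ℝ, F)) I (TotalSpace.proj : TotalSpace F V → M)
      (TotalSpace.mk' F x (s x)) (projVec I (TotalSpace.mk' F x (s x))) :=
    (mdifferentiable_proj V _).hasMFDerivAt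
  have h2 := h1.comp x hs.hasMFDerivAt
  have h3 : HasMFDerivAt I I ((TotalSpace.proj : TotalSpace F V → M) ∘
      fun y => TotalSpace.mk' F y (s y)) x (ContinuousLinearMap.id ℝ (TangentSpace I x)) :=
    hasMFDerivAt_id x
  exact congrArg (fun L => L Z) (hasMFDerivAt_unique h2 h3)

/-- `extend F v` is the local section that is constant in the trivialization over `x`. The section
defining the horizontal lift thus contributes nothing to the fibre coordinate, which then only sees
`-∇_Z (extend F v)`. -/
theorem trivializationAt_extend_eventuallyEq {x : M} (v : V x) :
    (fun y => (trivializationAt F V x ⟨y, extend F v y⟩).2) =ᶠ[𝓝 x]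
      fun _ => fibreCoord F x v := by
  filter_upwards [(trivializationAt F V x).open_baseSet.mem_nhds
    (mem_baseSet_trivializationAt F V x)] with y hy
  have h := (trivializationAt F V x).apply_mk_symm hy (trivializationAt F V x ⟨x, v⟩).2
  have h' := congrArg Prod.snd h
  rw [fibreCoord_apply]
  exact h'

theorem mvfderiv_trivializationAt_extend {x : M} (v : V x) :
    mvfderiv I (fun y => (trivializationAt F V x ⟨y, extend F v y⟩).2) x = 0 := by
  have h := ((hasMFDerivAt_const (I := I) (I' := 𝓘(ℝ, F)) (fibreCoord F x v) x).congr_of_eventuallyEq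
    (trivializationAt_extend_eventuallyEq v)).mfderiv
  rw [mvfderiv, h]
  rfl

/-- `ds(Z) = Z^h + β^v` if `β` is the covariant derivative of `s` along `Z`, in the sense that its
difference with the covariant derivative of `extend F (s x)` is the derivative of the fibre
coordinate of `s`. -/
theorem mfderiv_section_eq
    (nablaV : (σ : (x : M) → V x) → (x : M) → TangentSpace I x →ₗ[ℝ] V x)
    {s : (y : M) → V y} {x : M}
    (hs : MDifferentiableAt I (I.prod 𝓘(ℝ, F)) (fun y => TotalSpace.mk' F y (s y)) x)
    (Z : TangentSpace I x) (β : V x)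
    (hβ : fibreCoord F x (β - nablaV (extend F (s x)) x Z) =
      mvfderiv I (fun y => (trivializationAt F V x ⟨y, s y⟩).2) x Z) :
    mfderiv I (I.prod 𝓘(ℝ, F)) (fun y => TotalSpace.mk' F y (s y)) x Z =
      horizontalLift nablaV (TotalSpace.mk' F x (s x)) Z +
        verticalLift I (TotalSpace.mk' F x (s x)) β := by
  set q : TotalSpace F V := TotalSpace.mk' F x (s x) with hq
  set w := mfderiv I (I.prod 𝓘(ℝ, F)) (fun y => TotalSpace.mk' F y (s y)) x Z with hw
  -- Both sides are split as `X^h + γ^v`; the projection to `M` identifies `X`, and the derivative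
  -- of the fibre coordinate then identifies `γ`.
  obtain ⟨⟨X, γ⟩, hXγ⟩ := (tangentSplitting nablaV q).surjective w
  rw [tangentSplitting_apply] at hXγ
  have hX : X = Z := by
    have h1 : projVec I q w = Z := projVec_mfderiv_section hs Z
    rw [← hXγ, map_add, projVec_horizontalLift, projVec_verticalLift, add_zero] at h1
    exact h1
  have hγ : γ = β := by
    have h1 : fibreCoordDeriv I q w = _ := fibreCoordDeriv_mfderiv_section hs q rfl Z
    have h2 : fibreCoordDeriv I q (extendDeriv I q Z) = (0 : F) := by
      refine (fibreCoordDeriv_mfderiv_section (mdifferentiableAt_extend I F (s x)) q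
        (by rw [extend_apply_self]) Z).trans ?_
      rw [mvfderiv_trivializationAt_extend, zero_apply]
    rw [← hβ, ← hXγ, hX, map_add, fibreCoordDeriv_verticalLift, horizontalLift,
      LinearMap.sub_apply, map_sub, LinearMap.comp_apply, fibreCoordDeriv_verticalLift,
      ContinuousLinearMap.coe_coe, h2, zero_sub, map_sub] at h1
    have h3 : fibreCoord F x γ = fibreCoord F x β := by
      have h4 : -(fibreCoord F x (nablaV (extend F (s x)) x Z)) + fibreCoord F x γ =
        fibreCoord F x β - fibreCoord F x (nablaV (extend F (s x)) x Z) := h1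
      rw [neg_add_eq_sub, sub_left_inj] at h4
      exact h4
    exact (fibreCoord F x).injective h3
  rw [← hXγ, hX, hγ]

theorem mvfderiv_clm_comp {F₁ F₂ : Type*} [NormedAddCommGroup F₁] [NormedSpace ℝ F₁]
    [NormedAddCommGroup F₂] [NormedSpace ℝ F₂] (L : F₁ →L[ℝ] F₂) {f : M → F₁} {x : M}
    (hf : MDifferentiableAt I 𝓘(ℝ, F₁) f x) (Z : TangentSpace I x) :
    mvfderiv I (fun y => L (f y)) x Z = L (mvfderiv I f x Z) :=
  congrArg (fun A => A Z) (L.hasMFDerivAt.comp x hf.hasMFDerivAt).mfderiv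

theorem mvfderiv_clm_apply {F₁ F₂ : Type*} [NormedAddCommGroup F₁] [NormedSpace ℝ F₁]
    [NormedAddCommGroup F₂] [NormedSpace ℝ F₂] {f : M → F₁ →L[ℝ] F₂} {x : M}
    (hf : MDifferentiableAt I 𝓘(ℝ, F₁ →L[ℝ] F₂) f x) (Z : TangentSpace I x) (v : F₁) :
    mvfderiv I (fun y => f y v) x Z = mvfderiv I f x Z v :=
  mvfderiv_clm_comp (ContinuousLinearMap.apply ℝ F₂ v) hf Z

theorem mdifferentiableAt_clm_apply {F₁ F₂ : Type*} [NormedAddCommGroup F₁] [NormedSpace ℝ F₁]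
    [NormedAddCommGroup F₂] [NormedSpace ℝ F₂] {f : M → F₁ →L[ℝ] F₂} {x : M}
    (hf : MDifferentiableAt I 𝓘(ℝ, F₁ →L[ℝ] F₂) f x) (v : F₁) :
    MDifferentiableAt I 𝓘(ℝ, F₂) (fun y => f y v) x :=
  (ContinuousLinearMap.apply ℝ F₂ v).mdifferentiableAt.comp x hf

end VectorBundleSplitting

/-! ### The covariant derivative of bilinear forms in coordinates -/

section Manifold4

variable {M : Type*} [TopologicalSpace M] [ChartedSpace E4 M] [IsManifold (𝓡 4) ∞ M]
  (nabla : CovariantDerivative (𝓡 4) E4 (TangentSpace (𝓡 4) : M → Type))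
  (D : CovariantDerivative (𝓡 4) ℝ (Density (M := M) 1))

theorem bilinCov_apply {B : (y : M) → WForm y} {x : M} (hB : MDiffForm B x)
    (Z : TangentSpace (𝓡 4) x) {X Y : (y : M) → TangentSpace (𝓡 4) y}
    (hX : MDiffField X x) (hY : MDiffField Y x) :
    bilinCov nabla D B x Z (X x) (Y x) = bilinCovAux nabla D B x Z X Y := by
  rw [bilinCov, dif_pos hB]
  exact TensorialAt.mkHom₂_apply
    (fun Y hY => bilinCovAux_tensorial_left nabla D hB Z Y hY)
    (fun X hX => bilinCovAux_tensorial_right nabla D hB Z X hX) hX hY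

/-- Write `τ = h μ²` with `μ` the local scale. The term `2 h μ Dμ` depends only on the value of `h`
at `x`, so it cancels in the difference. What remains is `dh`, and `h` is the coordinate of `τ`
because `μ` is constant in the trivialization. -/
theorem squareConnection_sub_of_eq {τ τ' : (y : M) → Density 2 y} {x : M} (h : τ x = τ' x)
    (Z : TangentSpace (𝓡 4) x) :
    squareConnection D τ x Z - squareConnection D τ' x Z =
      (mvfderiv (𝓡 4) (fun y => (trivializationAt ℝ (Density (M := M) 2) x ⟨y, τ y⟩).2) x Z -
        mvfderiv (𝓡 4)
          (fun y => (trivializationAt ℝ (Density (M := M) 2) x ⟨y, τ' y⟩).2) x Z) •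
        densityUnit 2 x := by
  have h1 : ∀ τ : (y : M) → Density 2 y, squareConnection D τ x Z =
      (mvfderiv (𝓡 4)
        (fun y => (trivializationAt ℝ (Density (M := M) 2) x ⟨y, τ y⟩).2) x Z) •
          densityMul x (localScale x x) (localScale x x) +
      (2 * densityRatio (τ x) (densityMul x (localScale x x) (localScale x x))) •
        densityMul x (localScale x x) (D (localScale x) x Z) := by
    intro τ
    have h := (densityRatio_localScale_eventuallyEq τ x).mfderiv_eq (I := 𝓡 4) (I' := 𝓘(ℝ, ℝ))
    have h' : mvfderiv (𝓡 4) (fun y => (trivializationAt ℝ (Density (M := M) 2) x ⟨y, τ y⟩).2) x =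
      mvfderiv (𝓡 4)
        (fun y => densityRatio (τ y) (densityMul y (localScale x y) (localScale x y))) x :=
      h.symm
    rw [h']
    rfl
  have h2 : densityMul x (localScale x x) (localScale x x) = densityUnit 2 x := by
    have : localScale x x = densityUnit 1 x := extend_apply_self _ _
    rw [this]
    exact one_mul (1 : ℝ)
  rw [h1, h1, h, h2, sub_smul]
  abel

theorem trivializationAt_densityUnit (w : ℝ) (x : M) :
    (trivializationAt ℝ (Density (M := M) w) x).linearMapAt ℝ x (densityUnit w x) = (1 : ℝ) := by
  rw [Trivialization.linearMapAt_apply, if_pos (mem_baseSet_trivializationAt ℝ _ x)]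
  exact (densityCore M w).coordChange_self (achart E4 x) x (mem_chart_source E4 x) 1

theorem trivializationAt_form_apply {x y : M} (hy : y ∈ (chartAt E4 x).source) (β : WForm y)
    (v w : E4) :
    (trivializationAt BilinForm4 (WForm (M := M)) x ⟨y, β⟩).2 v w =
      (trivializationAt ℝ (Density (M := M) 2) x).linearMapAt ℝ y
        (β ((trivializationAt E4 (TangentSpace (𝓡 4) : M → Type) x).symm y v)
          ((trivializationAt E4 (TangentSpace (𝓡 4) : M → Type) x).symm y w)) :=
  inCoordinates_apply_eq₂ (E₁ := (TangentSpace (𝓡 4) : M → Type))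
    (E₂ := (TangentSpace (𝓡 4) : M → Type)) (E₃ := Density (M := M) 2) hy hy hy

/-- Evaluating on the pair `(v, w)` is linear and commutes with the derivative; near `x` it amounts
to evaluating `B` on the two vector fields with constant coordinates `v` and `w`. -/
theorem mfderiv_form_apply {B : (y : M) → WForm y} {x : M} (hB : MDiffForm B x)
    (Z : TangentSpace (𝓡 4) x) (v w : E4) :
    mvfderiv (𝓡 4)
        (fun y => (trivializationAt BilinForm4 (WForm (M := M)) x ⟨y, B y⟩).2) x Z v w =
      mvfderiv (𝓡 4) (fun y => (trivializationAt ℝ (Density (M := M) 2) x ⟨y,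
        B y ((trivializationAt E4 (TangentSpace (𝓡 4) : M → Type) x).symm y v)
          ((trivializationAt E4 (TangentSpace (𝓡 4) : M → Type) x).symm y w)⟩).2) x Z := by
  have hB' := (mdifferentiableAt_section (𝓡 4) B).1 hB
  rw [← mvfderiv_clm_apply hB', ← mvfderiv_clm_apply (mdifferentiableAt_clm_apply hB' v)]
  suffices h : (fun y => (trivializationAt BilinForm4 (WForm (M := M)) x ⟨y, B y⟩).2 v w) =ᶠ[𝓝 x]
      fun y => (trivializationAt ℝ (Density (M := M) 2) x ⟨y,
        B y ((trivializationAt E4 (TangentSpace (𝓡 4) : M → Type) x).symm y v)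
          ((trivializationAt E4 (TangentSpace (𝓡 4) : M → Type) x).symm y w)⟩).2 from
    congrArg (fun L => L Z) (h.mfderiv_eq (I := 𝓡 4) (I' := 𝓘(ℝ, ℝ)))
  filter_upwards [(chartAt E4 x).open_source.mem_nhds (mem_chart_source E4 x)] with y hy
  refine (trivializationAt_form_apply hy (B y) v w).trans ?_
  rw [Trivialization.linearMapAt_apply]
  exact if_pos hy

/-- For forms agreeing at `x`, the terms `B(∇X, Y)` and `B(X, ∇Y)` cancel in the difference of
covariant derivatives. With `B'` the extension of `B x`, this is what `mfderiv_section_eq` requires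
of a covariant derivative. -/
theorem fibreCoord_bilinCov_sub {B B' : (y : M) → WForm y} {x : M} (hB : MDiffForm B x)
    (hB' : MDiffForm B' x) (h : B x = B' x) (Z : TangentSpace (𝓡 4) x) :
    fibreCoord BilinForm4 x (bilinCov nabla D B x Z - bilinCov nabla D B' x Z) =
      (mvfderiv (𝓡 4)
        (fun y => (trivializationAt BilinForm4 (WForm (M := M)) x ⟨y, B y⟩).2) x Z -
      mvfderiv (𝓡 4)
        (fun y => (trivializationAt BilinForm4 (WForm (M := M)) x ⟨y, B' y⟩).2) x Z) := by
  -- The field with constant coordinates `v` is `extend` of its own value at `x`, hence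
  -- differentiable there.
  have hfield : ∀ v : E4, MDiffField
      (fun y => (trivializationAt E4 (TangentSpace (𝓡 4) : M → Type) x).symm y v) x := by
    intro v
    have h1 := mdifferentiableAt_extend (𝓡 4) E4
      ((trivializationAt E4 (TangentSpace (𝓡 4) : M → Type) x).symm x v)
    have h2 : (trivializationAt E4 (TangentSpace (𝓡 4) : M → Type) x
        ⟨x, (trivializationAt E4 (TangentSpace (𝓡 4) : M → Type) x).symm x v⟩).2 = v :=
      congrArg Prod.snd ((trivializationAt E4 (TangentSpace (𝓡 4) : M → Type) x).apply_mk_symm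
        (mem_baseSet_trivializationAt E4 _ x) v)
    simpa only [extend, h2] using h1
  ext v w
  rw [fibreCoord_apply]
  refine (trivializationAt_form_apply (mem_chart_source E4 x) _ v w).trans ?_
  rw [sub_apply, sub_apply, sub_apply, sub_apply, mfderiv_form_apply hB, mfderiv_form_apply hB',
    bilinCov_apply nabla D hB Z (hfield v) (hfield w),
    bilinCov_apply nabla D hB' Z (hfield v) (hfield w)]
  have h4 := squareConnection_sub_of_eq D (x := x)
    (τ := fun y => B y ((trivializationAt E4 (TangentSpace (𝓡 4) : M → Type) x).symm y v)
      ((trivializationAt E4 (TangentSpace (𝓡 4) : M → Type) x).symm y w))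
    (τ' := fun y => B' y ((trivializationAt E4 (TangentSpace (𝓡 4) : M → Type) x).symm y v)
      ((trivializationAt E4 (TangentSpace (𝓡 4) : M → Type) x).symm y w)) (by rw [h]) Z
  have h5 : ∀ a b p q : Density 2 x, a - p - q - (b - p - q) = a - b := fun a b p q => by abel
  rw [bilinCovAux, bilinCovAux, h, h5, h4, map_smul, trivializationAt_densityUnit]
  exact mul_one _

/-- The differential of a section `B` is `dB(Z) = Z^h + (∇_Z B)^v`. -/
theorem mfderiv_form_section {B : (y : M) → WForm y} {x : M} (hB : MDiffForm B x)
    (Z : TangentSpace (𝓡 4) x) :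
    mfderiv (𝓡 4) FormModel (fun y => TotalSpace.mk' BilinForm4 y (B y)) x Z =
      horizontalLift (bilinCov nabla D) (TotalSpace.mk' BilinForm4 x (B x)) Z +
        verticalLift (𝓡 4) (TotalSpace.mk' BilinForm4 x (B x)) (bilinCov nabla D B x Z) := by
  refine mfderiv_section_eq (bilinCov nabla D) hB Z _ ?_
  rw [fibreCoord_bilinCov_sub nabla D hB (mdifferentiableAt_extend (𝓡 4) BilinForm4 (B x))
    (extend_apply_self BilinForm4 (B x)).symm Z, mvfderiv_trivializationAt_extend]
  exact sub_zero (G := BilinForm4) _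

end Manifold4

/-! ### The conformal Kähler form -/

/-- Smoothness of the composition of smooth bundle homomorphisms. -/
theorem contMDiff_clm_bundle_comp
    {EB : Type*} [NormedAddCommGroup EB] [NormedSpace ℝ EB]
    {HB : Type*} [TopologicalSpace HB] {IB : ModelWithCorners ℝ EB HB}
    {B : Type*} [TopologicalSpace B] [ChartedSpace HB B] {n : WithTop ℕ∞}
    {F₁ F₂ F₃ : Type*} [NormedAddCommGroup F₁] [NormedSpace ℝ F₁]
    [NormedAddCommGroup F₂] [NormedSpace ℝ F₂] [NormedAddCommGroup F₃] [NormedSpace ℝ F₃]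
    {V₁ V₂ V₃ : B → Type*}
    [TopologicalSpace (TotalSpace F₁ V₁)] [∀ x, AddCommGroup (V₁ x)] [∀ x, Module ℝ (V₁ x)]
    [∀ x, TopologicalSpace (V₁ x)] [FiberBundle F₁ V₁] [VectorBundle ℝ F₁ V₁]
    [TopologicalSpace (TotalSpace F₂ V₂)] [∀ x, AddCommGroup (V₂ x)] [∀ x, Module ℝ (V₂ x)]
    [∀ x, TopologicalSpace (V₂ x)] [FiberBundle F₂ V₂] [VectorBundle ℝ F₂ V₂]
    [∀ x, IsTopologicalAddGroup (V₂ x)] [∀ x, ContinuousSMul ℝ (V₂ x)]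
    [TopologicalSpace (TotalSpace F₃ V₃)] [∀ x, AddCommGroup (V₃ x)] [∀ x, Module ℝ (V₃ x)]
    [∀ x, TopologicalSpace (V₃ x)] [FiberBundle F₃ V₃] [VectorBundle ℝ F₃ V₃]
    [∀ x, IsTopologicalAddGroup (V₃ x)] [∀ x, ContinuousSMul ℝ (V₃ x)]
    {ψ : (x : B) → V₂ x →L[ℝ] V₃ x} {φ : (x : B) → V₁ x →L[ℝ] V₂ x}
    (hψ : ContMDiff IB (IB.prod 𝓘(ℝ, F₂ →L[ℝ] F₃)) n
      (fun x => TotalSpace.mk' (F₂ →L[ℝ] F₃) (E := fun x => V₂ x →L[ℝ] V₃ x) x (ψ x)))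
    (hφ : ContMDiff IB (IB.prod 𝓘(ℝ, F₁ →L[ℝ] F₂)) n
      (fun x => TotalSpace.mk' (F₁ →L[ℝ] F₂) (E := fun x => V₁ x →L[ℝ] V₂ x) x (φ x))) :
    ContMDiff IB (IB.prod 𝓘(ℝ, F₁ →L[ℝ] F₃)) n
      (fun x => TotalSpace.mk' (F₁ →L[ℝ] F₃) (E := fun x => V₁ x →L[ℝ] V₃ x) x
        ((ψ x).comp (φ x))) := by
  intro x
  have h1 := (contMDiffAt_hom_bundle _).1 (hψ x)
  have h2 := (contMDiffAt_hom_bundle _).1 (hφ x)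
  refine (contMDiffAt_hom_bundle _).2 ⟨h1.1, (h1.2.clm_comp h2.2).congr_of_eventuallyEq ?_⟩
  -- Coordinates of a composite are the composite of the coordinates only where the trivialization
  -- of the middle bundle is invertible.
  filter_upwards [(trivializationAt F₂ V₂ x).open_baseSet.mem_nhds
    (mem_baseSet_trivializationAt F₂ V₂ x)] with y hy
  ext v
  simp only [ContinuousLinearMap.inCoordinates, ContinuousLinearMap.comp_apply,
    Trivialization.symmL_continuousLinearMapAt _ hy]

section Manifold4

variable {M : Type*} [TopologicalSpace M] [ChartedSpace E4 M] [IsManifold (𝓡 4) ∞ M]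
  {c : ConformalMetric M} {J : AlmostComplexStructure M}
  {nabla : CovariantDerivative (𝓡 4) E4 (TangentSpace (𝓡 4) : M → Type)}
  {D : CovariantDerivative (𝓡 4) ℝ (Density (M := M) 1)}

theorem contMDiff_kaehlerForm (c : ConformalMetric M) (J : AlmostComplexStructure M) :
    ContMDiff (𝓡 4) FormModel ∞
      (fun x => TotalSpace.mk' BilinForm4 x (kaehlerForm c J x)) :=
  contMDiff_clm_bundle_comp (V₃ := fun x : M => TangentSpace (𝓡 4) x →L[ℝ] Density 2 x)
    c.smooth J.smooth

theorem mdiffForm_kaehlerForm (c : ConformalMetric M) (J : AlmostComplexStructure M) (x : M) :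
    MDiffForm (kaehlerForm c J) x :=
  (contMDiff_kaehlerForm c J).mdifferentiable (by simp) x

theorem mdiffForm_metric (c : ConformalMetric M) (x : M) : MDiffForm c.form x :=
  c.smooth.mdifferentiable (by simp) x

theorem AlmostComplexStructure.mdiffField (J : AlmostComplexStructure M) {x : M}
    {X : (y : M) → TangentSpace (𝓡 4) y} (hX : MDiffField X x) :
    MDiffField (fun y => J.toFun y (X y)) x :=
  (J.smooth.mdifferentiable (by simp) x).clm_bundle_apply hX

theorem mdiffField_extend {x : M} (v : TangentSpace (𝓡 4) x) : MDiffField (extend E4 v) x :=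
  mdifferentiableAt_extend (𝓡 4) E4 v

theorem kaehlerForm_apply (c : ConformalMetric M) (J : AlmostComplexStructure M) (x : M)
    (v w : TangentSpace (𝓡 4) x) : kaehlerForm c J x v w = c.form x (J.toFun x v) w := rfl

theorem kaehlerForm_swap (hcJ : IsConformallyAlmostHermitian c J) (x : M)
    (v w : TangentSpace (𝓡 4) x) : kaehlerForm c J x v w = -kaehlerForm c J x w v := by
  rw [kaehlerForm_apply, kaehlerForm_apply, hcJ x (J.toFun x v) w, J.sq, map_neg,
    neg_apply, c.symm x v]

theorem isTwoForm_kaehlerForm (hcJ : IsConformallyAlmostHermitian c J) (x : M) :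
    IsTwoForm (kaehlerForm c J x) := fun v =>
  haveI : IsAddTorsionFree (Density 2 x) := inferInstanceAs (IsAddTorsionFree ℝ)
  self_eq_neg.1 (kaehlerForm_swap hcJ x v v)

theorem squareConnection_zero (D : CovariantDerivative (𝓡 4) ℝ (Density (M := M) 1)) (x : M) :
    squareConnection D (fun _ => 0) x = 0 :=
  (squareConnection D).isCovariantDerivativeOnUniv.zero

/-- `(∇_Z ω)(X, Y) = c(∇_Z (J X) - J ∇_Z X, Y)`. -/
theorem bilinCov_kaehlerForm_apply (hnabla : IsWeylConnection c D nabla) {x : M}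
    (Z : TangentSpace (𝓡 4) x) {X : (y : M) → TangentSpace (𝓡 4) y} (hX : MDiffField X x)
    (w : TangentSpace (𝓡 4) x) :
    bilinCov nabla D (kaehlerForm c J) x Z (X x) w =
      c.form x (nabla (fun y => J.toFun y (X y)) x Z - J.toFun x (nabla X x Z)) w := by
  have hY := mdiffField_extend w
  have h1 := bilinCov_apply nabla D (mdiffForm_kaehlerForm c J x) Z hX hY
  -- Parallelism of `c`, evaluated on `JX` and `Y`: `D_Z (ω(X, Y)) = c(∇_Z (JX), Y) + c(JX, ∇_Z Y)`.
  -- The last term cancels against the one in `∇ω`.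
  have h2 := bilinCov_apply nabla D (mdiffForm_metric c x) Z (J.mdiffField hX) hY
  rw [hnabla.2 x] at h2
  rw [bilinCovAux, extend_apply_self] at h1 h2
  simp only [kaehlerForm_apply, LinearMap.zero_apply, zero_apply] at h1 h2
  rw [h1, map_sub, sub_apply]
  rw [eq_comm, sub_sub, sub_eq_zero] at h2
  rw [h2]
  abel

/-- Along the extended field `ω(X, X)` vanishes identically, so its derivative does too, and the two
remaining terms cancel by skewness of `ω`. -/
theorem isTwoForm_bilinCov_kaehlerForm (hcJ : IsConformallyAlmostHermitian c J) {x : M}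
    (Z : TangentSpace (𝓡 4) x) : IsTwoForm (bilinCov nabla D (kaehlerForm c J) x Z) := by
  intro v
  have hX := mdiffField_extend v
  have h1 := bilinCov_apply nabla D (mdiffForm_kaehlerForm c J x) Z hX hX
  rw [bilinCovAux, extend_apply_self] at h1
  have h2 : (fun y => kaehlerForm c J y (extend E4 v y) (extend E4 v y)) = fun _ => 0 :=
    funext fun y => isTwoForm_kaehlerForm hcJ y _
  rw [h1, h2, squareConnection_zero, kaehlerForm_swap hcJ x _ v, zero_apply]
  abel

theorem bilinCov_kaehlerForm_swap (hcJ : IsConformallyAlmostHermitian c J) {x : M}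
    (Z v w : TangentSpace (𝓡 4) x) :
    bilinCov nabla D (kaehlerForm c J) x Z v w = -bilinCov nabla D (kaehlerForm c J) x Z w v := by
  have h := isTwoForm_bilinCov_kaehlerForm (nabla := nabla) (D := D) hcJ Z
  have h1 := h (v + w)
  rw [map_add, map_add, add_apply, add_apply, h v, h w, zero_add, add_zero] at h1
  exact eq_neg_of_add_eq_zero_right h1

/-- `∇_Z ω` is anti-invariant under `J`. -/
theorem bilinCov_kaehlerForm_antiInvariant (hcJ : IsConformallyAlmostHermitian c J)
    (hnabla : IsWeylConnection c D nabla) {x : M} (Z v w : TangentSpace (𝓡 4) x) :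
    bilinCov nabla D (kaehlerForm c J) x Z (J.toFun x v) (J.toFun x w) =
      -bilinCov nabla D (kaehlerForm c J) x Z v w := by
  have hX := mdiffField_extend v
  have h1 := bilinCov_kaehlerForm_apply (J := J) hnabla Z hX w
  have h2 := bilinCov_kaehlerForm_apply (J := J) hnabla Z (J.mdiffField hX) (J.toFun x w)
  -- `J(JX) = -X` along the whole field, so `∇_Z (J(JX)) = -∇_Z X`. Then `h2` evaluates `c` on `-∇_Z
  -- X - J ∇_Z (JX) = -J(∇_Z (JX) - J ∇_Z X)` and `Jw`, and orthogonality removes the outer `J`.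
  have h3 : (fun y => J.toFun y (J.toFun y (extend E4 v y))) = (-1 : ℝ) • extend E4 v := by
    funext y
    rw [J.sq, Pi.smul_apply, neg_one_smul]
  have h4 := nabla.isCovariantDerivativeOnUniv.smul_const (-1) hX
  rw [h3] at h2
  rw [extend_apply_self] at h1 h2
  rw [h1, h2, ← neg_apply, ← map_neg, hcJ x (-_) w]
  congr 2
  rw [show nabla ((-1 : ℝ) • extend E4 v) x = (-1 : ℝ) • nabla (extend E4 v) x from h4]
  simp [J.sq]

/-- The cyclic sum of `∇ω` vanishes, as `d^D ω = 0` and the Weyl connection is torsion free. -/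
theorem bilinCov_kaehlerForm_cyclic (hcJ : IsConformallyAlmostHermitian c J)
    (hD : IsCanonicalWeylDerivative c J D) (hnabla : IsWeylConnection c D nabla) {x : M}
    (u v w : TangentSpace (𝓡 4) x) :
    bilinCov nabla D (kaehlerForm c J) x u v w + bilinCov nabla D (kaehlerForm c J) x v w u +
      bilinCov nabla D (kaehlerForm c J) x w u v = 0 := by
  have hω := mdiffForm_kaehlerForm c J x
  have hu := mdiffField_extend u
  have hv := mdiffField_extend v
  have hw := mdiffField_extend w
  have h1 := bilinCov_apply nabla D hω u hv hw
  have h2 := bilinCov_apply nabla D hω v hu hw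
  have h3 := bilinCov_apply nabla D hω w hu hv
  have h4 := hD x _ _ _ hu hv hw
  have t1 := nabla.torsion_eq_zero_iff.1 hnabla.1 hu hv
  have t2 := nabla.torsion_eq_zero_iff.1 hnabla.1 hu hw
  have t3 := nabla.torsion_eq_zero_iff.1 hnabla.1 hv hw
  -- Vanishing torsion turns each Lie bracket into `∇_X Y - ∇_Y X`, after which `d^D ω` regroups
  -- into three covariant derivatives of `ω`.
  rw [extCov, ← t1, ← t2, ← t3] at h4
  rw [bilinCovAux] at h1 h2 h3
  simp only [extend_apply_self, map_sub, sub_apply] at h1 h2 h3 h4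
  rw [bilinCov_kaehlerForm_swap hcJ v w u, h1, h2, h3]
  rw [kaehlerForm_swap hcJ x v, kaehlerForm_swap hcJ x u, kaehlerForm_swap hcJ x u]
  rw [← h4]
  abel

/-- `∇_{JZ} ω = J (∇_Z ω)`. -/
theorem bilinCov_kaehlerForm_J (hcJ : IsConformallyAlmostHermitian c J)
    (hD : IsCanonicalWeylDerivative c J D) (hnabla : IsWeylConnection c D nabla) {x : M}
    (Z : TangentSpace (𝓡 4) x) :
    bilinCov nabla D (kaehlerForm c J) x (J.toFun x Z) =
      formAct (J.toFun x) (bilinCov nabla D (kaehlerForm c J) x Z) := by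
  ext v w
  change _ = bilinCov nabla D (kaehlerForm c J) x Z (J.toFun x v) w
  have anti := fun a b d => bilinCov_kaehlerForm_antiInvariant (x := x) hcJ hnabla a b d
  have cyc := fun a b d => bilinCov_kaehlerForm_cyclic (x := x) hcJ hD hnabla a b d
  -- Anti-invariance with `J² = -1` lets `J` pass from the second form argument to the first, so
  -- that equal terms of the cyclic sums become syntactically equal.
  have move : ∀ a b d : TangentSpace (𝓡 4) x,
      bilinCov nabla D (kaehlerForm c J) x a b (J.toFun x d) =
        bilinCov nabla D (kaehlerForm c J) x a (J.toFun x b) d := by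
    intro a b d
    have h := anti a b (J.toFun x d)
    rw [J.sq, map_neg, neg_inj] at h
    exact h.symm
  have h1 := cyc (J.toFun x Z) v w
  have h2 := cyc Z (J.toFun x v) w
  have h3 := cyc Z v (J.toFun x w)
  have h4 := cyc (J.toFun x Z) (J.toFun x v) (J.toFun x w)
  rw [anti, anti, anti] at h4
  simp only [move] at h1 h2 h3
  generalize bilinCov nabla D (kaehlerForm c J) x (J.toFun x Z) v w = a at *
  generalize bilinCov nabla D (kaehlerForm c J) x Z (J.toFun x v) w = b at *
  generalize bilinCov nabla D (kaehlerForm c J) x (J.toFun x v) w Z = a' at *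
  generalize bilinCov nabla D (kaehlerForm c J) x (J.toFun x w) Z v = a'' at *
  generalize bilinCov nabla D (kaehlerForm c J) x v (J.toFun x w) Z = b' at *
  generalize bilinCov nabla D (kaehlerForm c J) x w (J.toFun x Z) v = b'' at *
  -- In the combination `h1 - h4 - h2 - h3` of the cyclic identities all terms with derivative along
  -- `v`, `w`, `Jv` or `Jw` cancel, which leaves `2a - 2b`.
  have h5 : (2 : ℝ) • a = (2 : ℝ) • b := by
    rw [← sub_eq_zero]
    calc (2 : ℝ) • a - (2 : ℝ) • b
        = (a + b' + b'') - (-a + -a' + -a'') - (b + a' + b'') - (b + b' + a'') := by module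
      _ = 0 := by rw [h1, h2, h3, h4]; simp
  exact smul_right_injective _ (two_ne_zero (α := ℝ)) h5

end Manifold4

/-! ### Self-duality of the conformal Kähler form -/

/-- The matrix of an orthogonal complex structure on a four-dimensional space, in an orthonormal
frame, is self-dual if the complex frames `(e₀, J e₀, eₖ, J eₖ)` with `k = 1, 2` are positive. -/
theorem selfDual_of_orthogonal_complex {a b c d f g : ℝ}
    (h00 : a * a + b * b + c * c = 1) (h11 : a * a + d * d + f * f = 1)
    (h22 : b * b + d * d + g * g = 1) (h33 : c * c + f * f + g * g = 1)
    (h12 : a * b + f * g = 0) (h13 : a * c = d * g) (h23 : b * c + d * f = 0)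
    (hpos1 : c * d - b * f ≠ 0 → 0 < c * d - b * f)
    (hpos2 : a * g + c * d ≠ 0 → 0 < a * g + c * d) :
    g = a ∧ f = -b ∧ d = c := by
  -- `p` is the Pfaffian of the skew matrix with upper entries `a, b, c, d, f, g`. The next
  -- identities say that the Hodge star multiplies the matrix by `p`, and `p² = 1`.
  obtain ⟨p, hp⟩ : ∃ p, p = a * g - b * f + c * d := ⟨_, rfl⟩
  have hg : g = p * a := by rw [hp]; linear_combination (-g) * h11 + f * h12 - d * h13
  have hf : f = -(p * b) := by rw [hp]; linear_combination (-f) * h22 + g * h12 + d * h23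
  have hd : d = p * c := by rw [hp]; linear_combination (-d) * h33 - g * h13 + f * h23
  have hp2 : p * p = 1 := by
    have h1 : d * d + f * f + g * g = 1 := by
      linear_combination (h11 + h22 + h33 - h00) / 2
    have h2 : d * d + f * f + g * g = p * p * (a * a + b * b + c * c) := by
      rw [hd, hf, hg]; ring
    rw [h1, h00, mul_one] at h2
    exact h2.symm
  rcases mul_self_eq_one_iff.1 hp2 with h | h
  · subst h
    exact ⟨by linarith, by linarith, by linarith⟩
  · exfalso
    subst h
    -- In the anti-self-dual case both frame determinants are minus sums of squares, so neither can
    -- be positive and both vanish. Two frames are needed since one alone may be degenerate;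
    -- together they force `a = b = c = 0`, against `h00`.
    have e1 : c * d - b * f = -(c * c + b * b) := by rw [hd, hf]; ring
    have e2 : a * g + c * d = -(a * a + c * c) := by rw [hd, hg]; ring
    have z1 : c * d - b * f = 0 := by
      by_contra hne
      have := hpos1 hne
      rw [e1] at this
      linarith [mul_self_nonneg c, mul_self_nonneg b]
    have z2 : a * g + c * d = 0 := by
      by_contra hne
      have := hpos2 hne
      rw [e2] at this
      linarith [mul_self_nonneg c, mul_self_nonneg a]
    rw [e1] at z1
    rw [e2] at z2
    linarith [mul_self_nonneg a, mul_self_nonneg b, mul_self_nonneg c]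

section Manifold4

variable {M : Type*} [TopologicalSpace M] [ChartedSpace E4 M] [IsManifold (𝓡 4) ∞ M]
  {c : ConformalMetric M} {J : AlmostComplexStructure M}
  {o : (x : M) → Orientation ℝ (TangentSpace (𝓡 4) x) (Fin 4)}

/-- Positivity gives injectivity, and dimensions agree. This makes `inverse` in `endoOfForm` a
genuine inverse rather than its default value `0`. -/
theorem isInvertible_metric (c : ConformalMetric M) (x : M) : (c.form x).IsInvertible := by
  have hinj : Function.Injective (c.form x) := by
    rw [injective_iff_map_eq_zero]
    intro v hv
    by_contra hne
    have h := c.pos x v hne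
    rw [hv] at h
    exact lt_irrefl (0 : ℝ) h
  let f : E4 →L[ℝ] E4 →L[ℝ] ℝ := c.form x
  have hfin : Module.finrank ℝ E4 = Module.finrank ℝ (E4 →L[ℝ] ℝ) :=
    (InnerProductSpace.toDual ℝ E4).toLinearEquiv.finrank_eq
  let e : E4 ≃L[ℝ] (E4 →L[ℝ] ℝ) :=
    (LinearEquiv.ofInjectiveOfFinrankEq f.toLinearMap hinj hfin).toContinuousLinearEquiv
  exact ⟨e, rfl⟩

theorem endoOfForm_kaehlerSection (c : ConformalMetric M) (J : AlmostComplexStructure M) (x : M) :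
    endoOfForm c (kaehlerSection c J x) = J.toFun x := by
  ext1 v
  exact (isInvertible_metric c x).inverse_apply_eq.2 rfl

/-! ### Components of the Kähler form in a conformal frame -/

namespace IsConformalFrame

variable {x : M} {e : Module.Basis (Fin 4) ℝ (TangentSpace (𝓡 4) x)} {m : Density 2 x}

theorem scale_pos (he : IsConformalFrame c o x e m) : 0 < densityCoord m := by
  have h := c.pos x (e 0) (e.ne_zero 0)
  rwa [he.orthogonal, if_pos rfl] at h

theorem metric_eq_repr_smul (he : IsConformalFrame c o x e m) (v : TangentSpace (𝓡 4) x)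
    (j : Fin 4) : c.form x v (e j) = e.repr v j • m := by
  have h : c.form x (∑ i, e.repr v i • e i) (e j) = e.repr v j • m := by
    rw [map_sum, sum_apply]
    simp [he.orthogonal]
  rwa [e.sum_repr] at h

/-- Row `i` of the component matrix of `ω_c` lists the coordinates of `J eᵢ`; hence `J² = -1`
becomes a matrix identity in `sum_frameCoeff_mul`. -/
theorem repr_J (he : IsConformalFrame c o x e m) (i j : Fin 4) :
    e.repr (J.toFun x (e i)) j = frameCoeff e m (kaehlerForm c J x) i j := by
  rw [frameCoeff, kaehlerForm_apply, he.metric_eq_repr_smul]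
  exact (mul_div_cancel_right₀ _ he.scale_pos.ne').symm

theorem frameCoeff_swap (hcJ : IsConformallyAlmostHermitian c J)
    (i j : Fin 4) : frameCoeff e m (kaehlerForm c J x) i j =
      -frameCoeff e m (kaehlerForm c J x) j i := by
  rw [frameCoeff, kaehlerForm_swap hcJ]
  exact neg_div _ _

theorem sum_frameCoeff_mul (he : IsConformalFrame c o x e m) (i j : Fin 4) :
    ∑ k, frameCoeff e m (kaehlerForm c J x) i k * frameCoeff e m (kaehlerForm c J x) k j =
      if i = j then -1 else 0 := by
  have h1 : J.toFun x (∑ k, e.repr (J.toFun x (e i)) k • e k) = -e i := by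
    rw [e.sum_repr, J.sq]
  have h2 := congrArg (fun v => e.repr v j) h1
  simp only [map_sum, map_smul, Finsupp.coe_finsetSum, Finset.sum_apply, Finsupp.coe_smul,
    Pi.smul_apply, smul_eq_mul, he.repr_J, map_neg, Finsupp.coe_neg, Pi.neg_apply,
    Module.Basis.repr_self, Finsupp.single_apply] at h2
  rw [h2]
  split_ifs <;> simp

/-- A nonzero determinant makes the four vectors a basis, to which `ho` applies; it then has the
same orientation as `e`. -/
theorem det_complexFrame_pos (he : IsConformalFrame c o x e m) (ho : IsComplexOrientation J o)
    (u v : TangentSpace (𝓡 4) x)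
    (hdet : e.det ![u, J.toFun x u, v, J.toFun x v] ≠ 0) :
    0 < e.det ![u, J.toFun x u, v, J.toFun x v] := by
  obtain ⟨hli, hsp⟩ := e.is_basis_iff_det.2 (isUnit_iff_ne_zero.2 hdet)
  have hb : ⇑(Module.Basis.mk hli hsp.ge) = ![u, J.toFun x u, v, J.toFun x v] :=
    Module.Basis.coe_mk hli hsp.ge
  have h := ho x (Module.Basis.mk hli hsp.ge) (by rw [hb]; rfl) (by rw [hb]; rfl)
  have h' := (e.orientation_eq_iff_det_pos _).1 (he.positive.trans h.symm)
  rwa [hb] at h'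

theorem frameCoeff_kaehlerForm_selfDual (he : IsConformalFrame c o x e m)
    (hcJ : IsConformallyAlmostHermitian c J) (ho : IsComplexOrientation J o) :
    (frameCoeff e m (kaehlerForm c J x) 2 3 = frameCoeff e m (kaehlerForm c J x) 0 1 ∧
      frameCoeff e m (kaehlerForm c J x) 1 3 = -frameCoeff e m (kaehlerForm c J x) 0 2 ∧
      frameCoeff e m (kaehlerForm c J x) 1 2 = frameCoeff e m (kaehlerForm c J x) 0 3) ∧
    frameCoeff e m (kaehlerForm c J x) 0 1 ^ 2 + frameCoeff e m (kaehlerForm c J x) 0 2 ^ 2 +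
      frameCoeff e m (kaehlerForm c J x) 0 3 ^ 2 = 1 := by
  have hsq := fun i j => he.sum_frameCoeff_mul (J := J) i j
  have hsw := fun i j => frameCoeff_swap (e := e) (m := m) hcJ i j
  have hr := fun i j => he.repr_J (J := J) i j
  have hd1 := he.det_complexFrame_pos ho (e 0) (e 1)
  have hd2 := he.det_complexFrame_pos ho (e 0) (e 2)
  -- From here on only a skew real matrix `A` with `A² = -1` and the two determinant conditions
  -- matter.
  generalize frameCoeff e m (kaehlerForm c J x) = A at *
  have hdiag : ∀ i, A i i = 0 := fun i => self_eq_neg.1 (hsw i i)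
  have hdet1 : e.det ![e 0, J.toFun x (e 0), e 1, J.toFun x (e 1)] =
      A 0 3 * A 1 2 - A 0 2 * A 1 3 := by
    rw [Module.Basis.det_apply, Matrix.det_succ_column_zero]
    simp [Matrix.det_fin_three, Fin.sum_univ_succ, Module.Basis.toMatrix_apply, hr, hdiag]
    ring
  have hdet2 : e.det ![e 0, J.toFun x (e 0), e 2, J.toFun x (e 2)] =
      A 0 1 * A 2 3 + A 0 3 * A 1 2 := by
    rw [Module.Basis.det_apply, Matrix.det_succ_column_zero]
    simp [Matrix.det_fin_three, Fin.sum_univ_succ, Module.Basis.toMatrix_apply, hr, hdiag,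
      hsw 2 1]
    ring
  rw [hdet1] at hd1
  rw [hdet2] at hd2
  have h00 := hsq 0 0
  have h11 := hsq 1 1
  have h22 := hsq 2 2
  have h33 := hsq 3 3
  have h12 := hsq 1 2
  have h13 := hsq 1 3
  have h23 := hsq 2 3
  simp [Fin.sum_univ_four, hdiag, hsw 1 0, hsw 2 0, hsw 3 0, hsw 2 1, hsw 3 1, hsw 3 2]
    at h00 h11 h22 h33 h12 h13 h23
  refine ⟨selfDual_of_orthogonal_complex ?_ ?_ ?_ ?_ ?_ ?_ ?_ hd1 hd2, ?_⟩ <;> linarith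

end IsConformalFrame

/-- Substituting the self-dual relations makes `β ∧ ω` and `c(β, ω)` the same expression in the
components of `β`. In the norm each of the squares of `A 0 1`, `A 0 2`, `A 0 3` occurs twice, and
they add up to `1`, whence the value `2`. -/
theorem kaehlerSection_mem_twistorSpacePlus (hcJ : IsConformallyAlmostHermitian c J)
    (ho : IsComplexOrientation J o) (x : M) :
    kaehlerSection c J x ∈ twistorSpacePlus c o := by
  refine ⟨isTwoForm_kaehlerForm hcJ x,
    fun (e : Module.Basis (Fin 4) ℝ (TangentSpace (𝓡 4) x)) (m : Density 2 x)
      (he : IsConformalFrame c o x e m) β _ => ?_,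
    fun (e : Module.Basis (Fin 4) ℝ (TangentSpace (𝓡 4) x)) (m : Density 2 x)
      (he : IsConformalFrame c o x e m) => ?_⟩
  all_goals
    obtain ⟨⟨h1, h2, h3⟩, h4⟩ := he.frameCoeff_kaehlerForm_selfDual hcJ ho
    have i0 : Finset.Ioi (0 : Fin 4) = {1, 2, 3} := by decide
    have i1 : Finset.Ioi (1 : Fin 4) = {2, 3} := by decide
    have i2 : Finset.Ioi (2 : Fin 4) = {3} := by decide
    have i3 : Finset.Ioi (3 : Fin 4) = ∅ := by decide
    simp only [formWedge, formInner, kaehlerSection, Fin.sum_univ_four, i0, i1, i2, i3]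
    simp only [h1, h2, h3, Finset.sum_insert, Finset.sum_singleton, Finset.mem_insert,
      Finset.mem_singleton, Finset.sum_empty, Fin.reduceEq, or_self, not_false_eq_true]
  · ring
  · linear_combination 2 * h4

/-! ### Holomorphicity of the section -/

variable {D : CovariantDerivative (𝓡 4) ℝ (Density (M := M) 1)}
  {nabla : CovariantDerivative (𝓡 4) E4 (TangentSpace (𝓡 4) : M → Type)}

theorem kaehlerSectionDeriv_eq (nabla : CovariantDerivative (𝓡 4) E4 (TangentSpace (𝓡 4) : M → Type))
    (D : CovariantDerivative (𝓡 4) ℝ (Density (M := M) 1)) (x : M) (Z : TangentSpace (𝓡 4) x) :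
    kaehlerSectionDeriv c J x Z =
      horizontalLift (bilinCov nabla D) (kaehlerSection c J x) Z +
        verticalLift (𝓡 4) (kaehlerSection c J x) (bilinCov nabla D (kaehlerForm c J) x Z) :=
  mfderiv_form_section nabla D (mdiffForm_kaehlerForm c J x) Z

theorem bilinCov_kaehlerForm_mem_antiInvariantForms (hcJ : IsConformallyAlmostHermitian c J)
    (hnabla : IsWeylConnection c D nabla) (x : M) (Z : TangentSpace (𝓡 4) x) :
    bilinCov nabla D (kaehlerForm c J) x Z ∈ antiInvariantForms c (kaehlerSection c J x) := by
  refine ⟨isTwoForm_bilinCov_kaehlerForm hcJ Z, fun v w => ?_⟩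
  rw [endoOfForm_kaehlerSection]
  exact bilinCov_kaehlerForm_antiInvariant hcJ hnabla Z v w

theorem kaehlerSectionDeriv_mem_twistorTangent (hcJ : IsConformallyAlmostHermitian c J)
    (hnabla : IsWeylConnection c D nabla) (x : M) (Z : TangentSpace (𝓡 4) x) :
    kaehlerSectionDeriv c J x Z ∈ twistorTangent c D nabla (kaehlerSection c J x) := by
  rw [kaehlerSectionDeriv_eq nabla D]
  exact Submodule.add_mem_sup (LinearMap.mem_range_self _ _)
    (Submodule.mem_map_of_mem (bilinCov_kaehlerForm_mem_antiInvariantForms hcJ hnabla x Z))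

/-- Taking `A` as a variable equal to `J_q` allows `J` to be substituted for `J_q` without rewriting
inside types that depend on `q`. -/
theorem twistorJ_apply (c : ConformalMetric M)
    (D : CovariantDerivative (𝓡 4) ℝ (Density (M := M) 1))
    (nabla : CovariantDerivative (𝓡 4) E4 (TangentSpace (𝓡 4) : M → Type)) (q : FormTotal M)
    {A : TangentSpace (𝓡 4) q.proj →L[ℝ] TangentSpace (𝓡 4) q.proj} (hA : endoOfForm c q = A)
    (X : TangentSpace (𝓡 4) q.proj) (β : WForm q.proj) :
    twistorJ c D nabla q (horizontalLift (bilinCov nabla D) q X + verticalLift (𝓡 4) q β) =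
      horizontalLift (bilinCov nabla D) q (A X) + verticalLift (𝓡 4) q (formAct A β) := by
  subst hA
  exact splittingEnd_apply (bilinCov nabla D) q (endoOfForm c q).toLinearMap
    (formAct (endoOfForm c q)) X β

theorem kaehlerSectionDeriv_J (hcJ : IsConformallyAlmostHermitian c J)
    (hD : IsCanonicalWeylDerivative c J D) (hnabla : IsWeylConnection c D nabla) (x : M)
    (Z : TangentSpace (𝓡 4) x) :
    kaehlerSectionDeriv c J x (J.toFun x Z) =
      twistorJ c D nabla (kaehlerSection c J x) (kaehlerSectionDeriv c J x Z) := by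
  rw [kaehlerSectionDeriv_eq nabla D, kaehlerSectionDeriv_eq nabla D,
    bilinCov_kaehlerForm_J hcJ hD hnabla]
  exact (twistorJ_apply c D nabla (kaehlerSection c J x) (endoOfForm_kaehlerSection c J x) Z
    (bilinCov nabla D (kaehlerForm c J) x Z)).symm

end Manifold4

end WeylTwistor

open WeylTwistor in
theorem theorem2 {M : Type*} [TopologicalSpace M] [ChartedSpace E4 M] [IsManifold (𝓡 4) ∞ M]
    (c : ConformalMetric M) (J : AlmostComplexStructure M)
    (hcJ : IsConformallyAlmostHermitian c J)
    (o : (x : M) → Orientation ℝ (TangentSpace (𝓡 4) x) (Fin 4))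
    (ho : IsComplexOrientation J o)
    (D : CovariantDerivative (𝓡 4) ℝ (Density (M := M) 1))
    (hD : IsCanonicalWeylDerivative c J D)
    (nabla : CovariantDerivative (𝓡 4) E4 (TangentSpace (𝓡 4) : M → Type))
    (hnabla : IsWeylConnection c D nabla) :
    ContMDiff (𝓡 4) FormModel ∞ (kaehlerSection c J) ∧
    (∀ x : M, kaehlerSection c J x ∈ twistorSpacePlus c o) ∧
    (∀ (x : M) (Z : TangentSpace (𝓡 4) x),
      bilinCov nabla D (kaehlerForm c J) x (J.toFun x Z) =
        formAct (J.toFun x) (bilinCov nabla D (kaehlerForm c J) x Z)) ∧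
    (∀ (x : M) (Z : TangentSpace (𝓡 4) x),
      kaehlerSectionDeriv c J x Z ∈ twistorTangent c D nabla (kaehlerSection c J x)) ∧
    (∀ (x : M) (Z : TangentSpace (𝓡 4) x),
      kaehlerSectionDeriv c J x (J.toFun x Z) =
        twistorJ c D nabla (kaehlerSection c J x) (kaehlerSectionDeriv c J x Z)) := by
  refine ⟨contMDiff_kaehlerForm c J, kaehlerSection_mem_twistorSpacePlus hcJ ho,
    fun x Z => bilinCov_kaehlerForm_J hcJ hD hnabla Z,
    kaehlerSectionDeriv_mem_twistorTangent hcJ hnabla,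
    kaehlerSectionDeriv_J hcJ hD hnabla⟩
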